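/- Let $\Lambda\subset\mathbb{R}^2$ be a lattice (the subgroup generated by two linearly independent vectors) and let $h$ be the flat metric on the torus $\mathbb{T}^2=\mathbb{R}^2/\Lambda$. A geometric triangulation $T$ of $(\mathbb{T}^2,h)$ with finite vertex set $V$ is a triangulation whose edges are interior-disjoint locally geodesic segments (loops and multiple edges are allowed); equivalently, its inverse image in $\mathbb{R}^2$ is a $\Lambda$-periodic face-to-face triangulation by nondegenerate Euclidean triangles, finitely many up to $\Lambda$, whose vertices are exactly the lifts of the points of $V$. A flip replaces, in a quadrilateral of $\mathbb{R}^2$ formed by two adjacent lifted triangles (and in all its $\Lambda$-translates), one diagonal by the other. $T$ is Delaunay if every lifted triangle is inscribed in an open disk containing no lift of a point of $V$. The diameter $\operatorname{diam}(T)$ is the smallest diameter of a fundamental domain of $\mathbb{R}^2$ that is a union of lifts of triangles of $T$, i.e. of a connected union of closed lifted triangles containing exactly one lift of each triangle of $T$. Theorem. There is a constant $C_h$, depending only on $h$, such that for every finite set $V\subset\mathbb{T}^2$ of $n$ points and every geometric triangulation $T$ of $(\mathbb{T}^2,h)$ with vertex set $V$, there is a sequence of flips of length at most $C_h\cdot\operatorname{diam}(T)^2\cdot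 n^2$, all of whose intermediate triangulations are geometric triangulations with vertex set $V$, connecting $T$ to a Delaunay triangulation with vertex set $V$. -/

import Mathlib

open scoped Pointwise

noncomputable section

namespace FlatTorusFlips

/-- The Euclidean plane, the universal cover of every flat torus. -/
abbrev Plane : Type := EuclideanSpace ℝ (Fin 2)

/-- The flat torus `ℝ² / Λ`; the Euclidean structure `h` is given by the lattice `Λ`. -/
abbrev FlatTorus (Λ : Submodule ℤ Plane) : Type := Plane ⧸ Λ

/-- The universal covering projection `ρ : ℝ² → ℝ² / Λ`. -/
def proj (Λ : Submodule ℤ Plane) (x : Plane) : FlatTorus Λ := Submodule.Quotient.mk x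

/-- The orbit of a subset of the plane under translation by `Λ`: all lifts of its projection
that are translates of it. -/
def orbit (Λ : Submodule ℤ Plane) (t : Set Plane) : Set (Set Plane) :=
  {s | ∃ γ ∈ Λ, s = γ +ᵥ t}

/-- A geometric triangulation of the flat torus `ℝ² / Λ` with (finite) vertex set `V`, whose edges
are realized by locally geodesic segments. It is recorded by the faces of its inverse image in the
universal cover, a face being given by the set of its three corners; the faces of the triangulation
of the torus are the `Λ`-orbits of these. Loops and multiple edges on the torus are allowed. -/
@[ext]
structure GeometricTriangulation (Λ : Submodule ℤ Plane) (V : Finset (FlatTorus Λ)) where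
  /-- The lifts of the faces, each given by its set of corners. -/
  triangles : Set (Set Plane)
  /-- Every face is a nondegenerate Euclidean triangle. -/
  nondegenerate : ∀ t ∈ triangles,
    ∃ a b c : Plane, AffineIndependent ℝ ![a, b, c] ∧ t = {a, b, c}
  /-- The faces cover the plane. -/
  cover : ⋃ t ∈ triangles, convexHull ℝ t = Set.univ
  /-- Two faces meet along a common vertex, a common edge, or not at all, unless they are equal. -/
  face_to_face : ∀ s ∈ triangles, ∀ t ∈ triangles,
    convexHull ℝ s ∩ convexHull ℝ t = convexHull ℝ (s ∩ t)
  /-- The triangulation of the plane is the inverse image of one of the torus. -/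
  periodic : ∀ γ ∈ Λ, ∀ t ∈ triangles, γ +ᵥ t ∈ triangles
  /-- The vertices are exactly the lifts of the points of `V`. -/
  vertices : ⋃₀ triangles = proj Λ ⁻¹' (V : Set (FlatTorus Λ))
  /-- The triangulation of the torus has finitely many faces. -/
  finite : ∃ F : Set (Set Plane), F.Finite ∧ ∀ t ∈ triangles, ∃ s ∈ F, t ∈ orbit Λ s

namespace GeometricTriangulation

variable {Λ : Submodule ℤ Plane} {V : Finset (FlatTorus Λ)}

/-- `T'` is obtained from `T` by flipping one edge: for two adjacent lifted faces `abc` and `abd`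
sharing the edge `ab`, the diagonal `ab` of the quadrilateral is replaced by `cd`, and this is
projected to the torus, i.e. done simultaneously for all `Λ`-translates. -/
def IsFlip (T T' : GeometricTriangulation Λ V) : Prop :=
  ∃ a b c d : Plane, c ≠ d ∧ {a, b, c} ∈ T.triangles ∧ {a, b, d} ∈ T.triangles ∧
    T'.triangles =
      (T.triangles \ (orbit Λ {a, b, c} ∪ orbit Λ {a, b, d})) ∪
        (orbit Λ {c, d, a} ∪ orbit Λ {c, d, b})

/-- Every lifted face is inscribed in an open disk that contains no lift of a vertex. -/
def IsDelaunay (T : GeometricTriangulation Λ V) : Prop :=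
  ∀ t ∈ T.triangles, ∃ (p : Plane) (r : ℝ), t ⊆ Metric.sphere p r ∧
    Disjoint (Metric.ball p r) (proj Λ ⁻¹' (V : Set (FlatTorus Λ)))

/-- `Ω` is a fundamental domain that is a union of lifts of the faces of `T`: it is connected and is
the union of (closed) lifted faces, exactly one lift being taken from each face of `T`. -/
def IsTriangleDomain (T : GeometricTriangulation Λ V) (Ω : Set Plane) : Prop :=
  IsConnected Ω ∧ ∃ R ⊆ T.triangles,
    (∀ t ∈ T.triangles, ∃! s, s ∈ R ∧ s ∈ orbit Λ t) ∧ Ω = ⋃ t ∈ R, convexHull ℝ t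

/-- The diameter of `T`: the least diameter of a fundamental domain that is a union of lifts of the
faces of `T`. -/
def diam (T : GeometricTriangulation Λ V) : ℝ :=
  sInf (Metric.diam '' {Ω : Set Plane | T.IsTriangleDomain Ω})

end GeometricTriangulation

end FlatTorusFlips

end

namespace FlatTorusFlips

/-! Interpolate `‖x‖ ^ 2` linearly over the faces of a triangulation; this is `height`. If an edge
`ab` is not locally Delaunay, its two faces form a strictly convex quadrilateral
(`exists_quad_of_illegal`), and flipping `ab` to `cd` lowers the height everywhere weakly and at the
crossing of the diagonals strictly. Over an edge the height depends only on the two endpoints, so a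
flipped edge, or a lattice translate of it, can never return (`IsDescent.not_isEdge`). A
triangulation without illegal edges is Delaunay (`exists_illegal_edge`), so flipping illegal edges
can only stop at a Delaunay triangulation.

The number of flips is therefore at most the number of segments that can occur. At its midpoint an
edge of length `ℓ` has height `ℓ ^ 2 / 4` above the paraboloid, while the initial height is at most
`D ^ 2` above it when the faces have diameter at most `D`. Hence every edge met on the way has
length at most `2 * D` (`IsEdge.norm_sub_le`). Up to `Λ` there are `O((D + 1) ^ 2 * n ^ 2)` such
segments between lifts of vertices (`card_segments_le`). A face fits in any fundamental domain made
of faces, so `D` may be its diameter, and the lattice bounds this from below (`half_le_mul_diam`),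
which absorbs the additive constant.

Points of faces are handled through barycentric weights. Meeting face to face becomes uniqueness of
weights (`convexHull_inter_eq_iff`), and a flip adds multiples of the affine dependence `circuit` to
weights (`Quad.exchange`). This makes the validity of the flipped triangulation, also across
overlapping translates, and the comparison of heights algebraic. -/

/-! ### Barycentric weights. -/

/-- The total mass of a finitely supported weight. -/
noncomputable def mass : (Plane →₀ ℝ) →ₗ[ℝ] ℝ := Finsupp.linearCombination ℝ (fun _ => (1 : ℝ))

/-- The weighted sum of the points carrying a weight. -/
noncomputable def bary : (Plane →₀ ℝ) →ₗ[ℝ] Plane := Finsupp.linearCombination ℝ id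

/-- The weighted sum of the squared norms of the points carrying a weight. -/
noncomputable def energy : (Plane →₀ ℝ) →ₗ[ℝ] ℝ :=
  Finsupp.linearCombination ℝ (fun v : Plane => ‖v‖ ^ 2)

@[simp] lemma mass_single (v : Plane) (r : ℝ) : mass (Finsupp.single v r) = r := by
  simp [mass]

@[simp] lemma bary_single (v : Plane) (r : ℝ) : bary (Finsupp.single v r) = r • v := by
  simp [bary]

@[simp] lemma energy_single (v : Plane) (r : ℝ) :
    energy (Finsupp.single v r) = r * ‖v‖ ^ 2 := by
  simp [energy]

/-- `w` is a system of barycentric weights on `t` for the point `x`. -/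
structure IsWeight (t : Set Plane) (x : Plane) (w : Plane →₀ ℝ) : Prop where
  supp : ∀ v, v ∉ t → w v = 0
  nonneg : ∀ v, 0 ≤ w v
  mass_eq : mass w = 1
  bary_eq : bary w = x

lemma IsWeight.mem_of_pos {t : Set Plane} {x : Plane} {w : Plane →₀ ℝ} (h : IsWeight t x w)
    {v : Plane} (hv : 0 < w v) : v ∈ t := by
  by_contra hn
  exact hv.ne' (h.supp v hn)

lemma IsWeight.mono {s t : Set Plane} {x : Plane} {w : Plane →₀ ℝ} (h : IsWeight s x w)
    (hst : s ⊆ t) : IsWeight t x w :=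
  ⟨fun v hv => h.supp v fun hs => hv (hst hs), h.nonneg, h.mass_eq, h.bary_eq⟩

lemma mem_convexHull_iff_exists_isWeight {t : Set Plane} {x : Plane} :
    x ∈ convexHull ℝ t ↔ ∃ w, IsWeight t x w := by
  constructor
  · intro hx
    refine convexHull_min (t := {x | ∃ w, IsWeight t x w}) ?_ ?_ hx
    · intro v hv
      classical
      refine ⟨Finsupp.single v 1, ?_, ?_, by simp, by simp⟩
      · intro u hu
        rw [Finsupp.single_apply, if_neg]
        rintro rfl
        exact hu hv
      · intro u
        rw [Finsupp.single_apply]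
        split_ifs <;> simp
    · rintro x ⟨w, hw⟩ y ⟨u, hu⟩ p q hp hq hpq
      refine ⟨p • w + q • u, ?_, ?_, ?_, ?_⟩
      · intro v hv
        simp [hw.supp v hv, hu.supp v hv]
      · intro v
        have := hw.nonneg v
        have := hu.nonneg v
        simp only [Finsupp.coe_add, Finsupp.coe_smul, Pi.add_apply, Pi.smul_apply, smul_eq_mul]
        positivity
      · simp [hw.mass_eq, hu.mass_eq, hpq]
      · simp [hw.bary_eq, hu.bary_eq]
  · rintro ⟨w, hw⟩
    have h1 := hw.mass_eq
    have h2 := hw.bary_eq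
    simp only [mass, bary, Finsupp.linearCombination_apply, Finsupp.sum, smul_eq_mul, mul_one,
      id] at h1 h2
    rw [← h2]
    refine (convex_convexHull ℝ t).sum_mem (fun v _ => hw.nonneg v) h1 fun v hv => ?_
    refine subset_convexHull ℝ t ?_
    by_contra hn
    exact Finsupp.mem_support_iff.1 hv (hw.supp v hn)

/-- Affine independence of a set of points, in terms of weights. -/
def Indep (t : Set Plane) : Prop :=
  ∀ z : Plane →₀ ℝ, (∀ v, v ∉ t → z v = 0) → mass z = 0 → bary z = 0 → z = 0

lemma Indep.weight_unique {t : Set Plane} (ht : Indep t) {x : Plane} {w u : Plane →₀ ℝ}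
    (hw : IsWeight t x w) (hu : IsWeight t x u) : w = u := by
  refine sub_eq_zero.1 (ht _ ?_ ?_ ?_)
  · intro v hv
    simp [hw.supp v hv, hu.supp v hv]
  · simp [hw.mass_eq, hu.mass_eq]
  · simp [hw.bary_eq, hu.bary_eq]

/-- A weight carried by both `s` and `t` is carried by `s ∩ t`, and independence makes weights on
each set unique. The face-to-face condition is used, and proved for flips, in this form. -/
lemma convexHull_inter_eq_iff {s t : Set Plane} (hs : Indep s) (ht : Indep t) :
    convexHull ℝ s ∩ convexHull ℝ t = convexHull ℝ (s ∩ t) ↔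
      ∀ x w u, IsWeight s x w → IsWeight t x u → w = u := by
  constructor
  · intro h x w u hw hu
    have hx : x ∈ convexHull ℝ s ∩ convexHull ℝ t :=
      ⟨mem_convexHull_iff_exists_isWeight.2 ⟨w, hw⟩, mem_convexHull_iff_exists_isWeight.2 ⟨u, hu⟩⟩
    rw [h] at hx
    obtain ⟨y, hy⟩ := mem_convexHull_iff_exists_isWeight.1 hx
    rw [hs.weight_unique hw (hy.mono Set.inter_subset_left),
      ht.weight_unique hu (hy.mono Set.inter_subset_right)]
  · intro h
    refine Set.Subset.antisymm ?_ fun x hx => ⟨convexHull_mono Set.inter_subset_left hx,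
      convexHull_mono Set.inter_subset_right hx⟩
    rintro x ⟨hxs, hxt⟩
    obtain ⟨w, hw⟩ := mem_convexHull_iff_exists_isWeight.1 hxs
    obtain ⟨u, hu⟩ := mem_convexHull_iff_exists_isWeight.1 hxt
    refine mem_convexHull_iff_exists_isWeight.2 ⟨w, ?_, hw.nonneg, hw.mass_eq, hw.bary_eq⟩
    intro v hv
    by_cases hvs : v ∈ s
    · rw [h x w u hw hu]
      exact hu.supp v fun hvt => hv ⟨hvs, hvt⟩
    · exact hw.supp v hvs

/-! ### Signed area and coordinates with respect to a triangle. -/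

/-- Twice the signed area of the triangle `abc`. -/
def cr (a b c : Plane) : ℝ := (b 0 - a 0) * (c 1 - a 1) - (b 1 - a 1) * (c 0 - a 0)

lemma plane_ext {x y : Plane} (h0 : x 0 = y 0) (h1 : x 1 = y 1) : x = y := by
  ext i
  fin_cases i
  · exact h0
  · exact h1

lemma cr_rotate (a b c : Plane) : cr b c a = cr a b c := by
  unfold cr; ring

lemma cr_swap (a b c : Plane) : cr b a c = -cr a b c := by
  unfold cr; ring

lemma cr_self_left (a c : Plane) : cr a a c = 0 := by
  unfold cr; ring

lemma cr_self_right (a b : Plane) : cr a b b = 0 := by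
  unfold cr; ring

lemma cr_self_outer (a b : Plane) : cr a b a = 0 := by
  unfold cr; ring

lemma cr_add (γ a b c : Plane) : cr (γ + a) (γ + b) (γ + c) = cr a b c := by
  simp only [cr, PiLp.add_apply]; ring

/-- The signed area is affine in its last argument. -/
lemma cr_comb {α β κ : ℝ} (h : α + β + κ = 1) (p q a b c : Plane) :
    cr p q (α • a + β • b + κ • c) = α * cr p q a + β * cr p q b + κ * cr p q c := by
  obtain rfl : κ = 1 - α - β := by linarith
  simp only [cr, PiLp.add_apply, PiLp.smul_apply, smul_eq_mul]
  ring

lemma affineIndependent_iff_cr (a b c : Plane) :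
    AffineIndependent ℝ ![a, b, c] ↔ cr a b c ≠ 0 := by
  rw [affineIndependent_iff_linearIndependent_vsub ℝ _ (0 : Fin 3)]
  have e : (fun i : { x : Fin 3 // x ≠ 0 } => (![a, b, c] i -ᵥ ![a, b, c] 0 : Plane)) =
      ![b - a, c - a] ∘ (finSuccAboveEquiv (0 : Fin 3)).symm := by
    ext ⟨i, hi⟩ : 1
    fin_cases i
    · exact absurd rfl hi
    · have : (finSuccAboveEquiv (0 : Fin 3)).symm ⟨1, hi⟩ = (0 : Fin 2) := by
        rw [Equiv.symm_apply_eq]; rfl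
      simp [this]
    · have : (finSuccAboveEquiv (0 : Fin 3)).symm ⟨2, hi⟩ = (1 : Fin 2) := by
        rw [Equiv.symm_apply_eq]; rfl
      simp [this]
  rw [e]
  have e2 := linearIndependent_equiv (R := ℝ) (finSuccAboveEquiv (0 : Fin 3)).symm
    (f := ![b - a, c - a])
  refine (Iff.trans e2 LinearIndependent.pair_iff).trans ?_
  constructor
  · intro h h0
    have k1 := h (c 1 - a 1) (-(b 1 - a 1)) (by
      refine plane_ext ?_ ?_ <;>
        simp only [PiLp.add_apply, PiLp.smul_apply, PiLp.sub_apply, smul_eq_mul, PiLp.zero_apply]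
      · unfold cr at h0; linear_combination h0
      · ring)
    have k2 := h (c 0 - a 0) (-(b 0 - a 0)) (by
      refine plane_ext ?_ ?_ <;>
        simp only [PiLp.add_apply, PiLp.smul_apply, PiLp.sub_apply, smul_eq_mul, PiLp.zero_apply]
      · ring
      · unfold cr at h0; linear_combination -h0)
    have hb : b - a = 0 := plane_ext
      (by simp only [PiLp.sub_apply, PiLp.zero_apply]; linarith [k2.2])
      (by simp only [PiLp.sub_apply, PiLp.zero_apply]; linarith [k1.2])
    have := (h 1 0 (by simp [hb])).1
    exact one_ne_zero this
  · intro h s t hst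
    have h0 := congrArg (fun x : Plane => x 0) hst
    have h1 := congrArg (fun x : Plane => x 1) hst
    simp only [PiLp.add_apply, PiLp.smul_apply, PiLp.sub_apply, smul_eq_mul,
      PiLp.zero_apply] at h0 h1
    constructor
    · refine (mul_eq_zero.1 (?_ : s * cr a b c = 0)).resolve_right h
      unfold cr; linear_combination (c 1 - a 1) * h0 - (c 0 - a 0) * h1
    · refine (mul_eq_zero.1 (?_ : t * cr a b c = 0)).resolve_right h
      unfold cr; linear_combination (b 0 - a 0) * h1 - (b 1 - a 1) * h0

lemma ne_of_cr_ne_zero {a b c : Plane} (h : cr a b c ≠ 0) : a ≠ b ∧ a ≠ c ∧ b ≠ c := by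
  refine ⟨?_, ?_, ?_⟩ <;> rintro rfl
  · exact h (cr_self_left _ _)
  · exact h (cr_self_outer _ _)
  · exact h (cr_self_right _ _)

lemma exists_coords {a b c : Plane} (h : cr a b c ≠ 0) (x : Plane) :
    ∃ α β κ : ℝ, α + β + κ = 1 ∧ x = α • a + β • b + κ • c := by
  refine ⟨cr x b c / cr a b c, cr a x c / cr a b c, cr a b x / cr a b c, ?_, ?_⟩
  · field_simp
    unfold cr; ring
  · refine plane_ext ?_ ?_ <;>
      simp only [PiLp.add_apply, PiLp.smul_apply, smul_eq_mul] <;>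
      field_simp <;> unfold cr <;> ring

/-- The weight with masses `α`, `β`, `κ` at `a`, `b`, `c`. -/
noncomputable def wt (a b c : Plane) (α β κ : ℝ) : Plane →₀ ℝ :=
  Finsupp.single a α + Finsupp.single b β + Finsupp.single c κ

lemma wt_apply_first {a b c : Plane} (hab : a ≠ b) (hac : a ≠ c) (α β κ : ℝ) :
    wt a b c α β κ a = α := by
  classical
  simp [wt, hab.symm, hac.symm]

lemma wt_apply_second {a b c : Plane} (hab : a ≠ b) (hbc : b ≠ c) (α β κ : ℝ) :
    wt a b c α β κ b = β := by
  classical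
  simp [wt, hab, hbc.symm]

lemma wt_apply_third {a b c : Plane} (hac : a ≠ c) (hbc : b ≠ c) (α β κ : ℝ) :
    wt a b c α β κ c = κ := by
  classical
  simp [wt, hac, hbc]

lemma wt_apply_of_notMem {a b c v : Plane} (hv : v ∉ ({a, b, c} : Set Plane)) (α β κ : ℝ) :
    wt a b c α β κ v = 0 := by
  classical
  simp only [Set.mem_insert_iff, Set.mem_singleton_iff, not_or] at hv
  simp [wt, Ne.symm hv.1, Ne.symm hv.2.1, Ne.symm hv.2.2]

lemma mass_wt (a b c : Plane) (α β κ : ℝ) : mass (wt a b c α β κ) = α + β + κ := by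
  simp [wt]

lemma bary_wt (a b c : Plane) (α β κ : ℝ) :
    bary (wt a b c α β κ) = α • a + β • b + κ • c := by
  simp [wt]

lemma energy_wt (a b c : Plane) (α β κ : ℝ) :
    energy (wt a b c α β κ) = α * ‖a‖ ^ 2 + β * ‖b‖ ^ 2 + κ * ‖c‖ ^ 2 := by
  simp [wt]

lemma eq_wt {a b c : Plane} (h : cr a b c ≠ 0) {w : Plane →₀ ℝ}
    (hw : ∀ v, v ∉ ({a, b, c} : Set Plane) → w v = 0) : w = wt a b c (w a) (w b) (w c) := by
  obtain ⟨h1, h2, h3⟩ := ne_of_cr_ne_zero h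
  ext v
  by_cases hv : v ∈ ({a, b, c} : Set Plane)
  · rcases hv with rfl | rfl | rfl
    · rw [wt_apply_first h1 h2]
    · rw [wt_apply_second h1 h3]
    · rw [wt_apply_third h2 h3]
  · rw [hw v hv, wt_apply_of_notMem hv]

lemma isWeight_wt {a b c : Plane} {α β κ : ℝ} (hα : 0 ≤ α) (hβ : 0 ≤ β)
    (hκ : 0 ≤ κ) (h1 : α + β + κ = 1) :
    IsWeight {a, b, c} (α • a + β • b + κ • c) (wt a b c α β κ) := by
  refine ⟨fun v hv => wt_apply_of_notMem hv _ _ _, fun v => ?_, by rw [mass_wt, h1],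
    bary_wt _ _ _ _ _ _⟩
  classical
  simp only [wt, Finsupp.coe_add, Pi.add_apply, Finsupp.single_apply]
  split_ifs <;> positivity

lemma indep_of_cr_ne_zero {a b c : Plane} (h : cr a b c ≠ 0) : Indep {a, b, c} := by
  intro z hz hm hb
  rw [eq_wt h hz] at hm hb
  rw [mass_wt] at hm
  rw [bary_wt] at hb
  have h0 := congrArg (fun x : Plane => x 0) hb
  have h1 := congrArg (fun x : Plane => x 1) hb
  simp only [PiLp.add_apply, PiLp.smul_apply, smul_eq_mul, PiLp.zero_apply] at h0 h1
  have ha : z a = -(z b + z c) := by linarith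
  rw [ha] at h0 h1
  have hb0 : z b = 0 := by
    refine (mul_eq_zero.1 (?_ : z b * cr a b c = 0)).resolve_right h
    unfold cr; linear_combination (c 1 - a 1) * h0 - (c 0 - a 0) * h1
  have hc0 : z c = 0 := by
    refine (mul_eq_zero.1 (?_ : z c * cr a b c = 0)).resolve_right h
    unfold cr; linear_combination (b 0 - a 0) * h1 - (b 1 - a 1) * h0
  rw [eq_wt h hz, ha, hb0, hc0]
  simp [wt]

lemma vadd_triple (γ a b c : Plane) :
    γ +ᵥ ({a, b, c} : Set Plane) = {γ + a, γ + b, γ + c} := by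
  ext x
  simp only [Set.mem_vadd_set, Set.mem_insert_iff, Set.mem_singleton_iff, vadd_eq_add]
  constructor
  · rintro ⟨y, rfl | rfl | rfl, rfl⟩ <;> simp
  · rintro (rfl | rfl | rfl)
    · exact ⟨a, by simp⟩
    · exact ⟨b, by simp⟩
    · exact ⟨c, by simp⟩

lemma convexHull_vadd_set (γ : Plane) (t : Set Plane) :
    convexHull ℝ (γ +ᵥ t) = γ +ᵥ convexHull ℝ t := convexHull_vadd γ t

/-! ### Weights, height and local finiteness in a triangulation. -/

namespace GeometricTriangulation

variable {Λ : Submodule ℤ Plane} {V : Finset (FlatTorus Λ)} (T : GeometricTriangulation Λ V)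

lemma exists_eq_triple {t : Set Plane} (ht : t ∈ T.triangles) :
    ∃ a b c, cr a b c ≠ 0 ∧ t = {a, b, c} := by
  obtain ⟨a, b, c, h, rfl⟩ := T.nondegenerate t ht
  exact ⟨a, b, c, (affineIndependent_iff_cr a b c).1 h, rfl⟩

lemma indep {t : Set Plane} (ht : t ∈ T.triangles) : Indep t := by
  obtain ⟨a, b, c, h, rfl⟩ := T.exists_eq_triple ht
  exact indep_of_cr_ne_zero h

lemma finite_corners {t : Set Plane} (ht : t ∈ T.triangles) : t.Finite := by
  obtain ⟨a, b, c, h, rfl⟩ := T.exists_eq_triple ht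
  exact Set.toFinite _

lemma nonempty_corners {t : Set Plane} (ht : t ∈ T.triangles) : t.Nonempty := by
  obtain ⟨a, b, c, h, rfl⟩ := T.exists_eq_triple ht
  exact ⟨a, by simp⟩

lemma cr_ne_zero {a b c : Plane} (ht : {a, b, c} ∈ T.triangles) : cr a b c ≠ 0 := by
  intro h0
  obtain ⟨x, y, z, h, e⟩ := T.exists_eq_triple ht
  have key : ∀ p q r : Plane, p ∈ ({a, b, c} : Set Plane) → q ∈ ({a, b, c} : Set Plane) →
      r ∈ ({a, b, c} : Set Plane) → cr p q r = 0 := by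
    intro p q r hp hq hr
    simp only [Set.mem_insert_iff, Set.mem_singleton_iff] at hp hq hr
    unfold cr at h0 ⊢
    rcases hp with rfl | rfl | rfl <;> rcases hq with rfl | rfl | rfl <;>
      rcases hr with rfl | rfl | rfl <;>
        first | linear_combination h0 | linear_combination -h0 | ring1

  exact h (key x y z (by rw [e]; simp) (by rw [e]; simp) (by rw [e]; simp))

lemma weight_unique {s t : Set Plane} (hs : s ∈ T.triangles) (ht : t ∈ T.triangles) {x : Plane}
    {w u : Plane →₀ ℝ} (hw : IsWeight s x w) (hu : IsWeight t x u) : w = u :=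
  (convexHull_inter_eq_iff (T.indep hs) (T.indep ht)).1 (T.face_to_face s hs t ht) x w u hw hu

lemma exists_isWeight (x : Plane) : ∃ t ∈ T.triangles, ∃ w, IsWeight t x w := by
  have hx : x ∈ ⋃ t ∈ T.triangles, convexHull ℝ t := by rw [T.cover]; trivial
  simp only [Set.mem_iUnion] at hx
  obtain ⟨t, ht, hxt⟩ := hx
  exact ⟨t, ht, mem_convexHull_iff_exists_isWeight.1 hxt⟩

lemma nonempty_triangles : T.triangles.Nonempty :=
  let ⟨t, ht, _⟩ := T.exists_isWeight 0
  ⟨t, ht⟩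

/-- The piecewise linear function that agrees with `‖·‖ ^ 2` at the vertices of `T`. -/
noncomputable def height (x : Plane) : ℝ := energy (T.exists_isWeight x).choose_spec.2.choose

/-- The choices made in `height` do not matter, since weights of a point on different faces agree.
-/
lemma height_eq {t : Set Plane} (ht : t ∈ T.triangles) {x : Plane} {w : Plane →₀ ℝ}
    (hw : IsWeight t x w) : T.height x = energy w := by
  unfold height
  congr 1
  exact T.weight_unique (T.exists_isWeight x).choose_spec.1 ht
    (T.exists_isWeight x).choose_spec.2.choose_spec hw

lemma periodic_iff {γ : Plane} (hγ : γ ∈ Λ) {t : Set Plane} :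
    γ +ᵥ t ∈ T.triangles ↔ t ∈ T.triangles := by
  refine ⟨fun h => ?_, T.periodic γ hγ t⟩
  have := T.periodic (-γ) (neg_mem hγ) _ h
  rwa [neg_vadd_vadd] at this

lemma vertices_subset {t : Set Plane} (ht : t ∈ T.triangles) :
    t ⊆ proj Λ ⁻¹' (V : Set (FlatTorus Λ)) := by
  rw [← T.vertices]
  exact Set.subset_sUnion_of_mem ht

/-- A vertex lying in a closed face is a corner of it. -/
lemma mem_of_mem_convexHull {t : Set Plane} (ht : t ∈ T.triangles) {v : Plane}
    (hv : v ∈ proj Λ ⁻¹' (V : Set (FlatTorus Λ))) (hvt : v ∈ convexHull ℝ t) : v ∈ t := by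
  rw [← T.vertices] at hv
  obtain ⟨s, hs, hvs⟩ := hv
  obtain ⟨w, hw⟩ := mem_convexHull_iff_exists_isWeight.1 hvt
  have hsv : IsWeight s v (Finsupp.single v 1) := by
    classical
    refine ⟨fun u hu => ?_, fun u => ?_, by simp, by simp⟩
    · rw [Finsupp.single_apply, if_neg]
      rintro rfl
      exact hu hvs
    · rw [Finsupp.single_apply]
      split_ifs <;> simp
  have := T.weight_unique ht hs hw hsv
  exact hw.mem_of_pos (by rw [this]; simp)

section LocalFiniteness

variable [DiscreteTopology Λ]

lemma finite_lattice_inter (s : Set Plane) (hs : Bornology.IsBounded s) :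
    (s ∩ (Λ : Set Plane)).Finite := by
  have : DiscreteTopology Λ.toAddSubgroup := ‹DiscreteTopology Λ›
  have hc : IsClosed (Λ.toAddSubgroup : Set Plane) := AddSubgroup.isClosed_of_discrete
  exact Metric.finite_isBounded_inter_isClosed (isDiscrete_iff_discreteTopology.2
    ‹DiscreteTopology Λ›) hs hc

/-- Only finitely many faces meet a bounded set. -/
lemma finite_inter (B : Set Plane) (hB : Bornology.IsBounded B) :
    {t ∈ T.triangles | (convexHull ℝ t ∩ B).Nonempty}.Finite := by
  obtain ⟨F, hF, h⟩ := T.finite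
  have key : ∀ s ∈ F, {t | t ∈ T.triangles ∧ (convexHull ℝ t ∩ B).Nonempty ∧
      t ∈ orbit Λ s}.Finite := by
    intro s hs
    by_cases hsT : s ∈ T.triangles
    · have hbd : Bornology.IsBounded (B - convexHull ℝ s) :=
        hB.sub ((T.finite_corners hsT).isCompact_convexHull ℝ).isBounded
      refine ((finite_lattice_inter (Λ := Λ) _ hbd).image fun γ => γ +ᵥ s).subset ?_
      rintro t ⟨ht, ⟨x, hx, hxB⟩, γ, hγ, rfl⟩
      rw [convexHull_vadd_set] at hx
      obtain ⟨y, hy, rfl⟩ := hx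
      refine ⟨γ, ⟨⟨γ +ᵥ y, hxB, y, hy, ?_⟩, hγ⟩, rfl⟩
      simp [vadd_eq_add]
    · refine Set.finite_empty.subset ?_
      rintro t ⟨ht, -, γ, hγ, rfl⟩
      exact hsT ((T.periodic_iff hγ).1 ht)
  refine (hF.biUnion key).subset ?_
  rintro t ⟨ht, hB⟩
  obtain ⟨s, hs, hts⟩ := h t ht
  exact Set.mem_biUnion hs ⟨ht, hB, hts⟩

lemma locallyFinite : LocallyFinite fun t : T.triangles => convexHull ℝ (t : Set Plane) := by
  intro x
  refine ⟨Metric.ball x 1, Metric.ball_mem_nhds x one_pos, ?_⟩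
  refine Set.Finite.of_finite_image (f := Subtype.val) ?_ Subtype.val_injective.injOn
  refine (T.finite_inter (Metric.ball x 1) Metric.isBounded_ball).subset ?_
  rintro _ ⟨t, ht, rfl⟩
  exact ⟨t.2, ht⟩

lemma isClosed_iUnion_faces (R : Set (Set Plane)) (hR : R ⊆ T.triangles) :
    IsClosed (⋃ t ∈ R, convexHull ℝ t) := by
  have : (⋃ t ∈ R, convexHull ℝ t) = ⋃ t : R, convexHull ℝ (t : Set Plane) := by simp
  rw [this]
  refine LocallyFinite.isClosed_iUnion ?_ ?_
  · exact T.locallyFinite.comp_injective (g := fun t : R => (⟨t.1, hR t.2⟩ : T.triangles))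
      fun s t h => Subtype.ext (congrArg (fun z : T.triangles => z.1) h)
  · intro t
    exact (T.finite_corners (hR t.2)).isClosed_convexHull ℝ

end LocalFiniteness

/-! ### Faces along an edge. -/

/-- Two faces with a common edge that lie on the same side of it coincide. -/
lemma eq_of_same_side {a b c e : Plane} (hc : {a, b, c} ∈ T.triangles)
    (he : {a, b, e} ∈ T.triangles) (h : 0 < cr a b c * cr a b e) : e = c := by
  have hc0 := T.cr_ne_zero hc
  have he0 := T.cr_ne_zero he
  obtain ⟨α, β, κ, h1, hx⟩ := exists_coords hc0 e
  have hκ : cr a b e = κ * cr a b c := by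
    rw [hx, cr_comb h1, cr_self_outer, cr_self_right]; ring
  have hκ0 : 0 < κ := by
    rw [hκ] at h
    by_contra hn
    nlinarith [mul_self_nonneg (cr a b c)]
  -- The point with weight `ε` at `e` and the rest split equally between `a` and `b` lies in both
  -- faces once `ε` is small: with `ε * M = 1 / 4` its coordinates in `abc` stay nonnegative.
  -- Uniqueness of weights then forces `e` to be a corner of `abc`.
  set M : ℝ := 1 + |α| + |β| with hM
  have hMp : 1 ≤ M := by rw [hM]; linarith [abs_nonneg α, abs_nonneg β]
  obtain ⟨ε, hε⟩ : ∃ ε : ℝ, ε = 1 / (4 * M) := ⟨_, rfl⟩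
  have hε0 : 0 < ε := by rw [hε]; positivity
  have hεM : ε * M = 1 / 4 := by rw [hε]; field_simp
  have hα : -M ≤ α := by rw [hM]; linarith [abs_nonneg β, neg_abs_le α]
  have hβ : -M ≤ β := by rw [hM]; linarith [abs_nonneg α, neg_abs_le β]
  have hε4 : ε ≤ 1 / 4 := by nlinarith
  have w1 := isWeight_wt (a := a) (b := b) (c := e) (α := (1 - ε) / 2) (β := (1 - ε) / 2)
    (κ := ε) (by linarith) (by linarith) hε0.le (by ring)
  have w2 := isWeight_wt (a := a) (b := b) (c := c) (α := (1 - ε) / 2 + ε * α)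
    (β := (1 - ε) / 2 + ε * β) (κ := ε * κ) (by nlinarith) (by nlinarith) (by positivity)
    (by linear_combination ε * h1)
  have hxx : ((1 - ε) / 2) • a + ((1 - ε) / 2) • b + ε • e =
      ((1 - ε) / 2 + ε * α) • a + ((1 - ε) / 2 + ε * β) • b + (ε * κ) • c := by
    rw [hx]; module
  rw [← hxx] at w2
  have hw := T.weight_unique he hc w1 w2
  obtain ⟨h1, h2, h3⟩ := ne_of_cr_ne_zero he0
  have hmem : e ∈ ({a, b, c} : Set Plane) := by
    refine w2.mem_of_pos ?_
    rw [← hw, wt_apply_third h2 h3]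
    exact hε0
  rcases hmem with rfl | rfl | rfl
  · exact absurd rfl h2
  · exact absurd rfl h3
  · rfl

/-- Across each edge of a face there is an adjacent face. -/
lemma exists_adjacent [DiscreteTopology Λ] {a b c : Plane} (ht : {a, b, c} ∈ T.triangles) :
    ∃ d, {a, b, d} ∈ T.triangles ∧ cr a b c * cr a b d < 0 := by
  have hc0 := T.cr_ne_zero ht
  obtain ⟨n1, n2, n3⟩ := ne_of_cr_ne_zero hc0
  -- the points slightly beyond the midpoint of the edge
  let y : ℝ → Plane := fun ε => ((1 + ε) / 2) • a + ((1 + ε) / 2) • b + (-ε) • c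
  have hy : Continuous y := by fun_prop
  -- The faces missing the midpoint `y 0` have closed union, so a face containing a point just
  -- beyond the edge also contains the midpoint. There its weight is positive at `a` and `b`, so
  -- both are corners.
  have hcl : IsClosed (⋃ t ∈ {t ∈ T.triangles | y 0 ∉ convexHull ℝ t}, convexHull ℝ t) :=
    T.isClosed_iUnion_faces _ fun t ht => ht.1
  have hopen := hcl.isOpen_compl.preimage hy
  have h0 : (0 : ℝ) ∈ y ⁻¹' (⋃ t ∈ {t ∈ T.triangles | y 0 ∉ convexHull ℝ t},
      convexHull ℝ t)ᶜ := by
    simp only [Set.mem_preimage, Set.mem_compl_iff, Set.mem_iUnion, not_exists]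
    rintro t ⟨-, hn⟩ hm
    exact hn hm
  obtain ⟨r, hr, hball⟩ := Metric.isOpen_iff.1 hopen 0 h0
  have hε : r / 2 ∈ Metric.ball (0 : ℝ) r := by
    rw [Metric.mem_ball, Real.dist_eq, sub_zero, abs_of_pos (by linarith)]; linarith
  have hε2 := hball hε
  obtain ⟨s, hs, w, hw⟩ := T.exists_isWeight (y (r / 2))
  have hsy : y 0 ∈ convexHull ℝ s := by
    by_contra hn
    refine hε2 ?_
    simp only [Set.mem_iUnion]
    exact ⟨s, ⟨hs, hn⟩, mem_convexHull_iff_exists_isWeight.2 ⟨w, hw⟩⟩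
  obtain ⟨u, hu⟩ := mem_convexHull_iff_exists_isWeight.1 hsy
  have h0w := isWeight_wt (a := a) (b := b) (c := c) (α := (1 + 0) / 2) (β := (1 + 0) / 2)
    (κ := -0) (by norm_num) (by norm_num) (by norm_num) (by norm_num)
  have hu0 := T.weight_unique hs ht hu h0w
  have has : a ∈ s := hu.mem_of_pos (by rw [hu0, wt_apply_first n1 n2]; norm_num)
  have hbs : b ∈ s := hu.mem_of_pos (by rw [hu0, wt_apply_second n1 n3]; norm_num)
  obtain ⟨d, rfl⟩ : ∃ d, s = {a, b, d} := by
    obtain ⟨p, q, z, -, rfl⟩ := T.exists_eq_triple hs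
    simp only [Set.mem_insert_iff, Set.mem_singleton_iff] at has hbs
    rcases has with rfl | rfl | rfl <;> rcases hbs with rfl | rfl | rfl <;>
      first
      | exact absurd rfl n1
      | exact ⟨_, rfl⟩
      | (refine ⟨p, ?_⟩; ext; simp; tauto)
      | (refine ⟨q, ?_⟩; ext; simp; tauto)
      | (refine ⟨z, ?_⟩; ext; simp; tauto)
  refine ⟨d, hs, ?_⟩
  have hd0 := T.cr_ne_zero hs
  have e1 := eq_wt hd0 hw.supp
  have hm := hw.mass_eq
  have hb := hw.bary_eq
  rw [e1, mass_wt] at hm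
  rw [e1, bary_wt] at hb
  have hcr : cr a b (y (r / 2)) = w d * cr a b d := by
    rw [← hb, cr_comb hm, cr_self_outer, cr_self_right]; ring
  have hcr2 : cr a b (y (r / 2)) = -(r / 2) * cr a b c := by
    show cr a b (((1 + r / 2) / 2) • a + ((1 + r / 2) / 2) • b + (-(r / 2)) • c) = _
    rw [cr_comb (by ring), cr_self_outer, cr_self_right]; ring
  have hwd := hw.nonneg d
  have hpos : 0 < cr a b c * cr a b c := mul_self_pos.2 hc0
  have hh : w d * (cr a b c * cr a b d) = -(r / 2) * (cr a b c * cr a b c) := by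
    linear_combination cr a b c * (hcr2 - hcr)
  by_contra hn
  push Not at hn
  nlinarith [mul_nonneg hwd hn, mul_pos hr hpos]

end GeometricTriangulation

/-! ### Circumcircles and visibility angles. -/

lemma norm_sq_plane (x : Plane) : ‖x‖ ^ 2 = x 0 ^ 2 + x 1 ^ 2 := by
  rw [EuclideanSpace.norm_sq_eq, Fin.sum_univ_two]
  simp

/-- The set `t` lies on the circle with centre `p` and squared radius `ρ`. -/
def OnCircle (t : Set Plane) (p : Plane) (ρ : ℝ) : Prop := ∀ x ∈ t, ‖x - p‖ ^ 2 = ρ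

lemma norm_sub_sq_comb {α β κ : ℝ} (h : α + β + κ = 1) (a b c p : Plane) :
    ‖α • a + β • b + κ • c - p‖ ^ 2 =
      α * ‖a - p‖ ^ 2 + β * ‖b - p‖ ^ 2 + κ * ‖c - p‖ ^ 2 -
        (α * β * ‖a - b‖ ^ 2 + α * κ * ‖a - c‖ ^ 2 + β * κ * ‖b - c‖ ^ 2) := by
  obtain rfl : κ = 1 - α - β := by linarith
  simp only [norm_sq_plane, PiLp.add_apply, PiLp.sub_apply, PiLp.smul_apply, smul_eq_mul]
  ring

/-- The cone opposite to the corner `c` of an inscribed triangle lies outside of the circle. -/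
lemma le_of_opposite_cone {a b c p : Plane} {ρ α β κ : ℝ} (hc : OnCircle {a, b, c} p ρ)
    (h : α + β + κ = 1) (hα : α ≤ 0) (hβ : β ≤ 0) :
    ρ ≤ ‖α • a + β • b + κ • c - p‖ ^ 2 := by
  rw [norm_sub_sq_comb h, hc a (by simp), hc b (by simp), hc c (by simp)]
  obtain rfl : κ = 1 - α - β := by linarith
  -- Writing `κ = 1 + (-α - β)`, the excess over `ρ` is the square on the right plus the nonnegative
  -- sum in `h1`.
  have key : (-α - β) * (-α * ‖a - c‖ ^ 2 + -β * ‖b - c‖ ^ 2) - α * β * ‖a - b‖ ^ 2 =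
      ‖α • (a - c) + β • (b - c)‖ ^ 2 := by
    simp only [norm_sq_plane, PiLp.add_apply, PiLp.sub_apply, PiLp.smul_apply, smul_eq_mul]
    ring
  have h1 : 0 ≤ -α * ‖a - c‖ ^ 2 + -β * ‖b - c‖ ^ 2 := by
    have : 0 ≤ -α := by linarith
    have : 0 ≤ -β := by linarith
    positivity
  nlinarith [sq_nonneg ‖α • (a - c) + β • (b - c)‖]

lemma exists_onCircle {a b c : Plane} (h : cr a b c ≠ 0) :
    ∃ p ρ, OnCircle {a, b, c} p ρ := by
  have h2 : (2 * cr a b c) ≠ 0 := by simpa using h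
  -- Cramer's rule for the offset `(u, v)` from `a` to the circumcentre.
  obtain ⟨u, hu⟩ : ∃ u : ℝ, u * (2 * cr a b c) =
    (c 1 - a 1) * ‖b - a‖ ^ 2 - (b 1 - a 1) * ‖c - a‖ ^ 2 := ⟨_, div_mul_cancel₀ _ h2⟩
  obtain ⟨v, hv⟩ : ∃ v : ℝ, v * (2 * cr a b c) =
    (b 0 - a 0) * ‖c - a‖ ^ 2 - (c 0 - a 0) * ‖b - a‖ ^ 2 := ⟨_, div_mul_cancel₀ _ h2⟩
  refine ⟨!₂[a 0 + u, a 1 + v], u ^ 2 + v ^ 2, ?_⟩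
  have key : ∀ x : Plane, ‖x - !₂[a 0 + u, a 1 + v]‖ ^ 2 - (u ^ 2 + v ^ 2) =
      ‖x - a‖ ^ 2 - 2 * (u * (x 0 - a 0) + v * (x 1 - a 1)) := by
    intro x
    simp only [norm_sq_plane, PiLp.sub_apply]
    simp
    ring
  have fin : ∀ x : Plane, cr a b c * (‖x - a‖ ^ 2 - 2 * (u * (x 0 - a 0) + v * (x 1 - a 1))) = 0 →
      ‖x - !₂[a 0 + u, a 1 + v]‖ ^ 2 = u ^ 2 + v ^ 2 := by
    intro x hx
    have := (mul_eq_zero.1 hx).resolve_left h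
    linarith [key x]
  simp only [norm_sq_plane, PiLp.sub_apply] at hu hv fin
  intro x hx
  rw [norm_sq_plane]
  refine fin x ?_
  rcases hx with rfl | rfl | rfl
  · ring
  · unfold cr at *
    linear_combination (-(x 0 - a 0)) * hu - (x 1 - a 1) * hv
  · unfold cr at *
    linear_combination (-(x 0 - a 0)) * hu - (x 1 - a 1) * hv

/-- The powers with respect to the two circles differ by an affine function that vanishes at the
three corners, hence everywhere. Evaluation at the two centres gives `σ - ρ` and `ρ - σ` both equal
to the squared distance of the centres. -/
lemma OnCircle.radius_unique {a b c p q : Plane} {ρ σ : ℝ} (h : cr a b c ≠ 0)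
    (h1 : OnCircle {a, b, c} p ρ) (h2 : OnCircle {a, b, c} q σ) : ρ = σ := by
  have key : ∀ x : Plane, ‖x - p‖ ^ 2 - ρ = ‖x - q‖ ^ 2 - σ := by
    intro x
    obtain ⟨α, β, κ, hs, rfl⟩ := exists_coords h x
    rw [norm_sub_sq_comb hs, norm_sub_sq_comb hs, h1 a (by simp), h1 b (by simp), h1 c (by simp),
      h2 a (by simp), h2 b (by simp), h2 c (by simp)]
    linear_combination (ρ - σ) * hs
  have k1 := key p
  have k2 := key q
  rw [sub_self, norm_zero, norm_sub_rev] at k1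
  rw [sub_self, norm_zero] at k2
  linarith

/-- A point outside of a triangle lies beyond one of the edges. -/
lemma exists_beyond_edge {a b c v : Plane} (h : cr a b c ≠ 0)
    (hv : v ∉ convexHull ℝ ({a, b, c} : Set Plane)) :
    ∃ a' b' c', ({a', b', c'} : Set Plane) = {a, b, c} ∧ cr a' b' c' * cr a' b' v < 0 := by
  obtain ⟨α, β, κ, hs, rfl⟩ := exists_coords h v
  have hpos : 0 < cr a b c * cr a b c := mul_self_pos.2 h
  by_cases hα : α < 0
  · refine ⟨b, c, a, by ext; simp; tauto, ?_⟩
    rw [cr_comb hs, cr_self_outer, cr_self_right, cr_rotate]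
    nlinarith
  by_cases hβ : β < 0
  · refine ⟨c, a, b, by ext; simp; tauto, ?_⟩
    rw [cr_comb hs, cr_self_outer, cr_self_right, cr_rotate b c a, cr_rotate a b c]
    nlinarith
  by_cases hκ : κ < 0
  · refine ⟨a, b, c, rfl, ?_⟩
    rw [cr_comb hs, cr_self_outer, cr_self_right]
    nlinarith
  push Not at hα hβ hκ
  exact absurd (mem_convexHull_iff_exists_isWeight.2 ⟨_, isWeight_wt hα hβ hκ hs⟩) hv

/-- The cotangent of the angle at which the segment `ab` is seen from `v`. -/
noncomputable def cotAt (v a b : Plane) : ℝ :=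
  ((a 0 - v 0) * (b 0 - v 0) + (a 1 - v 1) * (b 1 - v 1)) / |cr v a b|

lemma cotAt_comm (v a b : Plane) : cotAt v a b = cotAt v b a := by
  unfold cotAt
  have : cr v b a = - cr v a b := by unfold cr; ring
  rw [this, abs_neg]
  congr 1
  ring

/-- The signs say that, seen from `v`, the point `a` lies strictly between `b` and `m`, so `bm` is
seen under a larger angle than `ab`. Algebraically, pair the relation `α • (a - v) + β • (b - v) + μ
• (m - v) = 0` with `b - v`. -/
lemma cotAt_lt {a b m v : Plane} {α β μ : ℝ} (h : cr a b m ≠ 0) (hs : α + β + μ = 1)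
    (hv : v = α • a + β • b + μ • m) (hα : α < 0) (hβ : 0 < β) (hμ : 0 < μ) (hb : b ≠ v) :
    cotAt v b m < cotAt v a b := by
  have e1 : cr v b m = α * cr a b m := by
    rw [← cr_rotate, hv, cr_comb hs, cr_self_outer, cr_self_right, cr_rotate]; ring
  have e2 : cr v a b = μ * cr a b m := by
    rw [← cr_rotate, hv, cr_comb hs, cr_self_outer, cr_self_right]; ring
  have hΔ : 0 < |cr a b m| := abs_pos.2 h
  have hbv : 0 < (b 0 - v 0) ^ 2 + (b 1 - v 1) ^ 2 := by
    have := norm_sq_plane (b - v)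
    simp only [PiLp.sub_apply] at this
    rw [← this]
    have : 0 < ‖b - v‖ := norm_pos_iff.2 (sub_ne_zero.2 hb)
    positivity
  unfold cotAt
  rw [e1, e2, abs_mul, abs_mul, abs_of_neg hα, abs_of_pos hμ,
    div_lt_div_iff₀ (mul_pos (neg_pos.2 hα) hΔ) (mul_pos hμ hΔ)]
  have h0 : v 0 = α * a 0 + β * b 0 + μ * m 0 := by rw [hv]; simp
  have h1 : v 1 = α * a 1 + β * b 1 + μ * m 1 := by rw [hv]; simp
  have key : -α * ((a 0 - v 0) * (b 0 - v 0) + (a 1 - v 1) * (b 1 - v 1)) -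
      μ * ((b 0 - v 0) * (m 0 - v 0) + (b 1 - v 1) * (m 1 - v 1)) =
      β * ((b 0 - v 0) ^ 2 + (b 1 - v 1) ^ 2) := by
    linear_combination (b 0 - v 0) * h0 + (b 1 - v 1) * h1 +
      ((b 0 - v 0) * v 0 + (b 1 - v 1) * v 1) * hs
  nlinarith [mul_pos hβ hbv, mul_pos hΔ (mul_pos hβ hbv)]

/-! ### Locally Delaunay implies Delaunay. -/

namespace GeometricTriangulation

variable {Λ : Submodule ℤ Plane} {V : Finset (FlatTorus Λ)} (T : GeometricTriangulation Λ V)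

/-- Translates have equal circumradii, and there are finitely many orbits of faces. -/
lemma exists_radius_bound : ∃ M : ℝ, ∀ t ∈ T.triangles, ∀ p ρ, OnCircle t p ρ → ρ ≤ M := by
  obtain ⟨F, hF, h⟩ := T.finite
  have key : ∀ s ∈ F, ∃ M : ℝ, s ∈ T.triangles → ∀ p ρ, OnCircle s p ρ → ρ ≤ M := by
    intro s hs
    by_cases hsT : s ∈ T.triangles
    · obtain ⟨a, b, c, habc, rfl⟩ := T.exists_eq_triple hsT
      obtain ⟨p, ρ, hp⟩ := exists_onCircle habc
      exact ⟨ρ, fun _ q σ hq => (hq.radius_unique habc hp).le⟩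
    · exact ⟨0, fun h => absurd h hsT⟩
  choose! M hM using key
  obtain ⟨D, hD⟩ := (hF.image M).bddAbove
  refine ⟨D, fun t ht p ρ hp => ?_⟩
  obtain ⟨s, hs, γ, hγ, rfl⟩ := h t ht
  rw [T.periodic_iff hγ] at ht
  refine (hM s hs ht (p - γ) ρ fun x hx => ?_).trans (hD ⟨s, hs, rfl⟩)
  rw [← hp (γ +ᵥ x) (Set.vadd_mem_vadd_set hx), vadd_eq_add]
  congr 2
  abel

/-- A triangulation that is not Delaunay has an edge that is not locally Delaunay. -/
lemma exists_illegal_edge [DiscreteTopology Λ] (hT : ¬ T.IsDelaunay) :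
    ∃ a b c d p ρ, {a, b, c} ∈ T.triangles ∧ {a, b, d} ∈ T.triangles ∧
      cr a b c * cr a b d < 0 ∧ OnCircle {a, b, c} p ρ ∧ ‖d - p‖ ^ 2 < ρ := by
  by_contra hleg
  push Not at hleg
  unfold IsDelaunay at hT
  push Not at hT
  obtain ⟨t, ht, hT⟩ := hT
  obtain ⟨a₀, b₀, c₀, h₀, rfl⟩ := T.exists_eq_triple ht
  obtain ⟨p₀, ρ₀, hp₀⟩ := exists_onCircle h₀
  have hρ₀ : 0 ≤ ρ₀ := by rw [← hp₀ a₀ (by simp)]; positivity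
  have hnd := hT p₀ (√ρ₀) (by
    intro x hx
    rw [Metric.mem_sphere, dist_eq_norm, ← hp₀ x hx, Real.sqrt_sq (norm_nonneg _)])
  rw [Set.not_disjoint_iff] at hnd
  obtain ⟨v, hvb, hv⟩ := hnd
  have hv₀ : ‖v - p₀‖ ^ 2 < ρ₀ := by
    rw [Metric.mem_ball, dist_eq_norm] at hvb
    exact (Real.lt_sqrt (norm_nonneg _)).1 hvb
  -- Pairs of a face whose circumdisk contains `v` and an edge of it, given by the first two
  -- entries, that separates the face from `v`. An extremal pair will be contradicted by crossing
  -- its edge.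
  let S : Set (Plane × Plane × Plane) := {x | {x.1, x.2.1, x.2.2} ∈ T.triangles ∧
    cr x.1 x.2.1 x.2.2 * cr x.1 x.2.1 v < 0 ∧
    ∃ p ρ, OnCircle {x.1, x.2.1, x.2.2} p ρ ∧ ‖v - p‖ ^ 2 < ρ}
  have hout : ∀ t ∈ T.triangles, ∀ p ρ, OnCircle t p ρ → ‖v - p‖ ^ 2 < ρ →
      v ∉ convexHull ℝ t := fun t ht p ρ hp hlt hvt =>
    hlt.ne (hp v (T.mem_of_mem_convexHull ht hv hvt))
  have hfin : S.Finite := by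
    obtain ⟨M, hM⟩ := T.exists_radius_bound
    have hP := (T.finite_inter (Metric.closedBall v (2 * √M)) Metric.isBounded_closedBall).biUnion
      (t := fun t => t) (fun t ht => T.finite_corners ht.1)
    refine ((hP.prod (hP.prod hP))).subset ?_
    rintro ⟨a, b, c⟩ ⟨habc, -, p, ρ, hp, hlt⟩
    have hρM := hM _ habc p ρ hp
    have hap : ‖a - p‖ ≤ √M := by
      refine Real.le_sqrt_of_sq_le ?_
      rw [hp a (by simp)]; exact hρM
    have hvp : ‖v - p‖ ≤ √M := Real.le_sqrt_of_sq_le (hlt.le.trans hρM)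
    have hmem : ({a, b, c} : Set Plane) ∈
        {t ∈ T.triangles | (convexHull ℝ t ∩ Metric.closedBall v (2 * √M)).Nonempty} := by
      refine ⟨habc, a, subset_convexHull ℝ _ (by simp), ?_⟩
      rw [Metric.mem_closedBall, dist_eq_norm]
      calc ‖a - v‖ = ‖(a - p) - (v - p)‖ := by congr 1; abel
        _ ≤ ‖a - p‖ + ‖v - p‖ := norm_sub_le _ _
        _ ≤ 2 * √M := by linarith
    exact ⟨Set.mem_biUnion hmem (by simp), Set.mem_biUnion hmem (by simp),
      Set.mem_biUnion hmem (by simp)⟩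
  have hne : S.Nonempty := by
    obtain ⟨a, b, c, e, hlt⟩ := exists_beyond_edge h₀ (hout _ ht p₀ ρ₀ hp₀ hv₀)
    exact ⟨(a, b, c), by rw [← e] at ht; exact ht, hlt, p₀, ρ₀, by rw [← e] at hp₀; exact hp₀, hv₀⟩
  -- Least cotangent means that the edge is seen from `v` under the largest angle.
  obtain ⟨⟨a, b, c⟩, ⟨habc, hside, p, ρ, hp, hlt⟩, hmin⟩ :=
    Set.exists_min_image S (fun x => cotAt v x.1 x.2.1) hfin hne
  dsimp only at habc hside hp
  obtain ⟨m, hm, hms⟩ := T.exists_adjacent habc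
  have hm0 := T.cr_ne_zero hm
  obtain ⟨α, β, μ, hs, hvc⟩ := exists_coords hm0 v
  have hcrv : cr a b v = μ * cr a b m := by
    rw [hvc, cr_comb hs, cr_self_outer, cr_self_right]; ring
  have hμ : 0 < μ := by
    rw [hcrv] at hside
    by_contra hn
    nlinarith
  obtain ⟨q, σ, hq⟩ := exists_onCircle hm0
  have hmp : ρ ≤ ‖m - p‖ ^ 2 := hleg a b c m p ρ habc hm hms hp
  -- The powers with respect to the two circles differ by an affine function vanishing on `ab`.
  -- Legality of `ab` fixes its sign at `m`, hence at `v`, which is on the same side: the power of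
  -- `v` does not increase.
  have hvq : ‖v - q‖ ^ 2 < σ := by
    have e1 := norm_sub_sq_comb hs a b m p
    have e2 := norm_sub_sq_comb hs a b m q
    rw [← hvc] at e1 e2
    rw [hp a (by simp), hp b (by simp)] at e1
    rw [hq a (by simp), hq b (by simp), hq m (by simp)] at e2
    obtain rfl : α = 1 - β - μ := by linarith
    nlinarith
  have hvm := hout _ hm q σ hq hvq
  have hnv : ∀ x ∈ ({a, b, m} : Set Plane), x ≠ v := by
    rintro x hx rfl
    exact hvm (subset_convexHull ℝ _ hx)
  -- `v` lies outside `abm` but on the side of `m`, so it is beyond `bm` or `am`. Not beyond both,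
  -- as the cone opposite to `m` misses the disk. By `cotAt_lt` the new edge is seen under a larger
  -- angle.
  have hneg : α < 0 ∨ β < 0 := by
    by_contra hn
    push Not at hn
    rw [hvc] at hvm
    exact hvm (mem_convexHull_iff_exists_isWeight.2 ⟨_, isWeight_wt hn.1 hn.2 hμ.le hs⟩)
  have hpos : 0 < cr a b m * cr a b m := mul_self_pos.2 hm0
  rcases hneg with hα | hβ
  · have hβ : 0 < β := by
      by_contra hn
      push Not at hn
      have := le_of_opposite_cone hq hs hα.le hn
      rw [← hvc] at this
      linarith
    have hset : ({b, m, a} : Set Plane) = {a, b, m} := by ext; simp; tauto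
    have hnew := hmin (b, m, a) ⟨by rw [hset]; exact hm, ?_, q, σ, by rw [hset]; exact hq, hvq⟩
    · exact absurd hnew (not_le.2 (cotAt_lt hm0 hs hvc hα hβ hμ (hnv b (by simp))))
    · dsimp only
      rw [hvc, cr_comb hs, cr_self_outer, cr_self_right, cr_rotate]
      nlinarith
  · have hs' : β + α + μ = 1 := by linarith
    have hvc' : v = β • b + α • a + μ • m := by rw [hvc]; abel
    have hset : ({b, a, m} : Set Plane) = {a, b, m} := by ext; simp; tauto
    have hset' : ({a, m, b} : Set Plane) = {a, b, m} := by ext; simp; tauto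
    have hα : 0 < α := by
      by_contra hn
      push Not at hn
      rw [← hset] at hq
      have := le_of_opposite_cone hq hs' hβ.le hn
      rw [← hvc'] at this
      linarith
    have hm0' : cr b a m ≠ 0 := by rw [cr_swap]; simpa using hm0
    have hnew := hmin (a, m, b) ⟨by rw [hset']; exact hm, ?_, q, σ, by rw [hset']; exact hq, hvq⟩
    · have := cotAt_lt hm0' hs' hvc' hβ hα hμ (hnv a (by simp))
      rw [cotAt_comm v b a] at this
      exact absurd hnew (not_le.2 this)
    · dsimp only
      rw [hvc', cr_comb hs', cr_self_outer, cr_self_right, cr_rotate, cr_swap]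
      nlinarith

end GeometricTriangulation

/-! ### Convex quadrilaterals and their affine dependence. -/

/-- The points `a`, `c`, `b`, `d` are the corners of a strictly convex quadrilateral whose
diagonals `ab` and `cd` cross in `α • a + β • b = κ • c + δ • d`. -/
structure Quad (a b c d : Plane) (α β κ δ : ℝ) : Prop where
  α_pos : 0 < α
  β_pos : 0 < β
  κ_pos : 0 < κ
  δ_pos : 0 < δ
  sum_ab : α + β = 1
  sum_cd : κ + δ = 1
  cross : α • a + β • b = κ • c + δ • d
  cr_ne : cr a b c ≠ 0

/-- The affine dependence between the corners of a quadrilateral. -/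
noncomputable def circuit (a b c d : Plane) (α β κ δ : ℝ) : Plane →₀ ℝ :=
  Finsupp.single c κ + Finsupp.single d δ - Finsupp.single a α - Finsupp.single b β

lemma circuit_symm (a b c d : Plane) (α β κ δ : ℝ) :
    circuit c d a b κ δ α β = -circuit a b c d α β κ δ := by
  unfold circuit; abel

namespace Quad

variable {a b c d : Plane} {α β κ δ : ℝ} (Q : Quad a b c d α β κ δ)

include Q

lemma cross_zero : α * a 0 + β * b 0 = κ * c 0 + δ * d 0 := by
  have := congrArg (fun x : Plane => x 0) Q.cross
  simpa using this

lemma cross_one : α * a 1 + β * b 1 = κ * c 1 + δ * d 1 := by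
  have := congrArg (fun x : Plane => x 1) Q.cross
  simpa using this

lemma cr_abd : δ * cr a b d = -κ * cr a b c := by
  obtain rfl : β = 1 - α := by linarith [Q.sum_ab]
  obtain rfl : δ = 1 - κ := by linarith [Q.sum_cd]
  have h0 := Q.cross_zero
  have h1 := Q.cross_one
  unfold cr
  linear_combination (b 1 - a 1) * h0 - (b 0 - a 0) * h1

lemma cr_cda : δ * cr c d a = -β * cr a b c := by
  obtain rfl : β = 1 - α := by linarith [Q.sum_ab]
  obtain rfl : δ = 1 - κ := by linarith [Q.sum_cd]
  have h0 := Q.cross_zero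
  have h1 := Q.cross_one
  unfold cr
  linear_combination (a 0 - c 0) * h1 - (a 1 - c 1) * h0

lemma cr_mul_neg : cr a b c * cr a b d < 0 := by
  have h := Q.cr_abd
  have hpos : 0 < cr a b c * cr a b c := mul_self_pos.2 Q.cr_ne
  have : δ * (cr a b c * cr a b d) = -(κ * (cr a b c * cr a b c)) := by
    linear_combination cr a b c * h
  have h2 := mul_pos Q.κ_pos hpos
  by_contra hn
  push Not at hn
  nlinarith [mul_nonneg Q.δ_pos.le hn]

lemma symm : Quad c d a b κ δ α β := by
  refine ⟨Q.κ_pos, Q.δ_pos, Q.α_pos, Q.β_pos, Q.sum_cd, Q.sum_ab, Q.cross.symm, fun h => ?_⟩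
  have := Q.cr_cda
  rw [h, mul_zero, neg_mul, zero_eq_neg] at this
  exact (mul_ne_zero Q.β_pos.ne' Q.cr_ne) this

lemma swap_right : Quad a b d c α β δ κ :=
  ⟨Q.α_pos, Q.β_pos, Q.δ_pos, Q.κ_pos, Q.sum_ab, by rw [add_comm]; exact Q.sum_cd,
    by rw [add_comm (δ • d)]; exact Q.cross, fun h => by simpa [h] using Q.cr_mul_neg⟩

lemma cr_cdb_ne : cr c d b ≠ 0 := Q.symm.swap_right.cr_ne

lemma translate (γ : Plane) : Quad (γ + a) (γ + b) (γ + c) (γ + d) α β κ δ := by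
  refine ⟨Q.α_pos, Q.β_pos, Q.κ_pos, Q.δ_pos, Q.sum_ab, Q.sum_cd, ?_, by
    rw [cr_add]; exact Q.cr_ne⟩
  have h1 : α • (γ + a) + β • (γ + b) = (α + β) • γ + (α • a + β • b) := by module
  have h2 : κ • (γ + c) + δ • (γ + d) = (κ + δ) • γ + (κ • c + δ • d) := by module
  rw [h1, h2, Q.cross, Q.sum_ab, Q.sum_cd]

lemma a_ne_b : a ≠ b := (ne_of_cr_ne_zero Q.cr_ne).1

lemma a_ne_c : a ≠ c := (ne_of_cr_ne_zero Q.cr_ne).2.1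

lemma b_ne_c : b ≠ c := (ne_of_cr_ne_zero Q.cr_ne).2.2

lemma mass_circuit : mass (circuit a b c d α β κ δ) = 0 := by
  simp only [circuit, map_sub, map_add, mass_single]
  linarith [Q.sum_ab, Q.sum_cd]

lemma bary_circuit : bary (circuit a b c d α β κ δ) = 0 := by
  simp only [circuit, map_sub, map_add, bary_single]
  rw [← Q.cross]
  abel

lemma circuit_a : circuit a b c d α β κ δ a = -α := by
  classical
  have h1 := Q.a_ne_b
  have h2 := Q.a_ne_c
  have h3 := Q.swap_right.a_ne_c
  simp [circuit, h1.symm, h2.symm, h3.symm]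

lemma circuit_b : circuit a b c d α β κ δ b = -β := by
  classical
  have h1 := Q.a_ne_b
  have h2 := Q.b_ne_c
  have h3 := Q.swap_right.b_ne_c
  simp [circuit, h1, h2.symm, h3.symm]

lemma circuit_c : circuit a b c d α β κ δ c = κ := by
  have := Q.symm.circuit_a
  rw [circuit_symm] at this
  simpa using this

lemma circuit_d : circuit a b c d α β κ δ d = δ := by
  have := Q.symm.circuit_b
  rw [circuit_symm] at this
  simpa using this

omit Q in
lemma circuit_of_notMem {v : Plane} (hv : v ∉ ({a, b, c, d} : Set Plane)) :
    circuit a b c d α β κ δ v = 0 := by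
  simp only [Set.mem_insert_iff, Set.mem_singleton_iff, not_or] at hv
  simp [circuit, Ne.symm hv.1, Ne.symm hv.2.1, Ne.symm hv.2.2.1, Ne.symm hv.2.2.2]

/-- The energy of the circuit is invariant under translation. -/
lemma energy_circuit_translate (γ : Plane) :
    energy (circuit (γ + a) (γ + b) (γ + c) (γ + d) α β κ δ) =
      energy (circuit a b c d α β κ δ) := by
  have h0 := Q.cross_zero
  have h1 := Q.cross_one
  simp only [circuit, map_sub, map_add, energy_single, norm_sq_plane, PiLp.add_apply]
  linear_combination -2 * γ 0 * h0 - 2 * γ 1 * h1 +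
    (γ 0 ^ 2 + γ 1 ^ 2) * (Q.sum_cd - Q.sum_ab)

/-- Weights on a quadrilateral can be moved to one of the triangles cut off by the diagonal
`cd`. -/
lemma exchange {x : Plane} {w : Plane →₀ ℝ} (hw : IsWeight {a, b, c, d} x w) :
    ∃ τ : ℝ, 0 ≤ τ ∧ (IsWeight {c, d, a} x (w + τ • circuit a b c d α β κ δ) ∨
      IsWeight {c, d, b} x (w + τ • circuit a b c d α β κ δ)) := by
  have hα := Q.α_pos
  have hβ := Q.β_pos
  have hκ := Q.κ_pos
  have hδ := Q.δ_pos
  have key : ∀ τ : ℝ, 0 ≤ τ → τ * α ≤ w a → τ * β ≤ w b →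
      IsWeight {a, b, c, d} x (w + τ • circuit a b c d α β κ δ) := by
    intro τ hτ ha hb
    refine ⟨fun v hv => ?_, fun v => ?_, ?_, ?_⟩
    · simp [hw.supp v hv, circuit_of_notMem hv]
    · by_cases hv : v ∈ ({a, b, c, d} : Set Plane)
      · have h0 := hw.nonneg v
        simp only [Finsupp.coe_add, Finsupp.coe_smul, Pi.add_apply, Pi.smul_apply, smul_eq_mul]
        rcases hv with rfl | rfl | rfl | rfl
        · rw [Q.circuit_a]; linarith
        · rw [Q.circuit_b]; linarith
        · rw [Q.circuit_c]; positivity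
        · rw [Q.circuit_d]; positivity
      · simp [hw.supp v hv, circuit_of_notMem hv]
    · simp [hw.mass_eq, Q.mass_circuit]
    · simp [hw.bary_eq, Q.bary_circuit]
  -- Take for `τ` the smaller ratio: the circuit is added until the weight at `a` or at `b` is
  -- exhausted.
  rcases le_total (w a / α) (w b / β) with h | h
  · have hτ : 0 ≤ w a / α := div_nonneg (hw.nonneg a) hα.le
    have h1 := key _ hτ (by rw [div_mul_cancel₀ _ hα.ne']) ((le_div_iff₀ hβ).1 h)
    refine ⟨_, hτ, Or.inr ⟨fun v hv => ?_, h1.nonneg, h1.mass_eq, h1.bary_eq⟩⟩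
    by_cases hva : v = a
    · rw [hva]
      simp [Q.circuit_a, hα.ne']
    · refine h1.supp v ?_
      simp only [Set.mem_insert_iff, Set.mem_singleton_iff] at hv ⊢
      tauto
  · have hτ : 0 ≤ w b / β := div_nonneg (hw.nonneg b) hβ.le
    have h1 := key _ hτ ((le_div_iff₀ hα).1 h) (by rw [div_mul_cancel₀ _ hβ.ne'])
    refine ⟨_, hτ, Or.inl ⟨fun v hv => ?_, h1.nonneg, h1.mass_eq, h1.bary_eq⟩⟩
    by_cases hvb : v = b
    · rw [hvb]
      simp [Q.circuit_b, hβ.ne']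
    · refine h1.supp v ?_
      simp only [Set.mem_insert_iff, Set.mem_singleton_iff] at hv ⊢
      tauto

lemma exchange_symm {x : Plane} {w : Plane →₀ ℝ} (hw : IsWeight {a, b, c, d} x w) :
    ∃ τ : ℝ, 0 ≤ τ ∧ (IsWeight {a, b, c} x (w - τ • circuit a b c d α β κ δ) ∨
      IsWeight {a, b, d} x (w - τ • circuit a b c d α β κ δ)) := by
  have hset : ({a, b, c, d} : Set Plane) = {c, d, a, b} := by ext; simp; tauto
  rw [hset] at hw
  have := Q.symm.exchange hw
  rw [circuit_symm] at this
  simpa only [smul_neg, ← sub_eq_add_neg] using this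

end Quad

/-! ### The flipped triangulation. -/

/-- A point of `t` furthest in direction `γ` would be moved further by a nonzero `γ`. -/
lemma eq_zero_of_vadd_eq {t : Set Plane} (ht : t.Finite) (hne : t.Nonempty) {γ : Plane}
    (h : γ +ᵥ t = t) : γ = 0 := by
  obtain ⟨x, hx, hmax⟩ := Set.exists_max_image t (fun y => γ 0 * y 0 + γ 1 * y 1) ht hne
  have hy : γ +ᵥ x ∈ t := by
    rw [← h]; exact Set.vadd_mem_vadd_set hx
  have := hmax _ hy
  simp only [vadd_eq_add, PiLp.add_apply] at this
  have h2 := norm_sq_plane γ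
  have h3 : ‖γ‖ ^ 2 ≤ 0 := by rw [h2]; nlinarith
  have h4 : ‖γ‖ = 0 := by
    have := sq_nonneg ‖γ‖
    exact pow_eq_zero_iff (two_ne_zero) |>.1 (le_antisymm h3 this)
  exact norm_eq_zero.1 h4

/-- Triangles on opposite sides of a common edge are not translates of each other. -/
lemma vadd_triple_ne {a b c d : Plane} (h : cr a b c * cr a b d < 0) (γ : Plane) :
    γ +ᵥ ({a, b, c} : Set Plane) ≠ {a, b, d} := by
  intro e
  rw [vadd_triple] at e
  have hc0 : cr a b c ≠ 0 := fun h0 => by simp [h0] at h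
  have hd0 : cr a b d ≠ 0 := fun h0 => by simp [h0] at h
  have hab := (ne_of_cr_ne_zero hc0).1
  -- `g` is the shift of `cr a b` under `γ`. If `g ≠ 0`, both `a` and `b` leave their line and must
  -- go to `d`; if `g = 0`, the image of `c` stays on the side of `c`, where `abd` has no corner.
  obtain ⟨g, hg⟩ : ∃ g : ℝ, g = (b 0 - a 0) * γ 1 - (b 1 - a 1) * γ 0 := ⟨_, rfl⟩
  have hshift : ∀ x, cr a b (γ + x) = g + cr a b x := by
    intro x
    rw [hg]
    simp only [cr, PiLp.add_apply]
    ring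
  have hcr : ∀ x ∈ ({a, b, d} : Set Plane), cr a b x = 0 ∨ x = d := by
    rintro x (rfl | rfl | rfl)
    · exact Or.inl (cr_self_outer _ _)
    · exact Or.inl (cr_self_right _ _)
    · exact Or.inr rfl
  have ha := hcr (γ + a) (by rw [← e]; simp)
  have hb := hcr (γ + b) (by rw [← e]; simp)
  have hc := hcr (γ + c) (by rw [← e]; simp)
  rw [hshift, cr_self_outer] at ha
  rw [hshift, cr_self_right] at hb
  by_cases hg0 : g = 0
  · rcases hc with hc | hc
    · rw [hshift, hg0, zero_add] at hc
      exact hc0 hc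
    · have := hshift c
      rw [hc, hg0, zero_add] at this
      rw [this] at h
      nlinarith [mul_self_nonneg (cr a b c)]
  · simp only [add_zero, hg0, false_or] at ha hb
    exact hab (add_left_cancel (ha.trans hb.symm))

namespace GeometricTriangulation

variable {Λ : Submodule ℤ Plane} {V : Finset (FlatTorus Λ)} (T : GeometricTriangulation Λ V)
  {a b c d : Plane} {α β κ δ : ℝ}

lemma exists_third_corner {t : Set Plane} (ht : t ∈ T.triangles) (hab : a ≠ b) (ha : a ∈ t)
    (hb : b ∈ t) : ∃ e, t = {a, b, e} := by
  obtain ⟨p, q, z, -, rfl⟩ := T.exists_eq_triple ht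
  simp only [Set.mem_insert_iff, Set.mem_singleton_iff] at ha hb
  rcases ha with rfl | rfl | rfl <;> rcases hb with rfl | rfl | rfl <;>
    first
    | exact absurd rfl hab
    | exact ⟨_, rfl⟩
    | (refine ⟨p, ?_⟩; ext; simp; tauto)
    | (refine ⟨q, ?_⟩; ext; simp; tauto)
    | (refine ⟨z, ?_⟩; ext; simp; tauto)

variable (Q : Quad a b c d α β κ δ) (hc : {a, b, c} ∈ T.triangles) (hd : {a, b, d} ∈ T.triangles)

include Q hc hd

/-- Move `w` back to an old face by subtracting `τ` times the circuit; there it equals `u`. If `τ >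
0`, then `u` is positive at `a` and `b`, so `s` has the edge `ab` and is one of the two excluded
faces. -/
lemma quad_weight_unique {s : Set Plane} (hs : s ∈ T.triangles) (hsc : s ≠ {a, b, c})
    (hsd : s ≠ {a, b, d}) {x : Plane} {u w : Plane →₀ ℝ} (hu : IsWeight s x u)
    (hw : IsWeight {a, b, c, d} x w) : u = w := by
  obtain ⟨τ, hτ, h⟩ := Q.exchange_symm hw
  have hu' : u = w - τ • circuit a b c d α β κ δ := by
    rcases h with h | h
    · exact T.weight_unique hs hc hu h
    · exact T.weight_unique hs hd hu h
  rcases hτ.eq_or_lt with rfl | hτ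
  · simpa using hu'
  exfalso
  have ha : a ∈ s := hu.mem_of_pos (by
    have h1 := mul_pos hτ Q.α_pos
    have h2 := hw.nonneg a
    rw [hu']
    simp only [Finsupp.coe_sub, Finsupp.coe_smul, Pi.sub_apply, Pi.smul_apply, smul_eq_mul,
      Q.circuit_a]
    linarith)
  have hb : b ∈ s := hu.mem_of_pos (by
    have h1 := mul_pos hτ Q.β_pos
    have h2 := hw.nonneg b
    rw [hu']
    simp only [Finsupp.coe_sub, Finsupp.coe_smul, Pi.sub_apply, Pi.smul_apply, smul_eq_mul,
      Q.circuit_b]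
    linarith)
  obtain ⟨e, rfl⟩ := T.exists_third_corner hs Q.a_ne_b ha hb
  have he := T.cr_ne_zero hs
  have hneg := Q.cr_mul_neg
  by_cases hce : 0 < cr a b c * cr a b e
  · exact hsc (by rw [T.eq_of_same_side hc hs hce])
  · suffices hde : 0 < cr a b d * cr a b e from hsd (by rw [T.eq_of_same_side hd hs hde])
    have h1 : cr a b c * cr a b e < 0 :=
      lt_of_le_of_ne (not_lt.1 hce) (mul_ne_zero Q.cr_ne he)
    have h2 := mul_pos_of_neg_of_neg hneg h1
    have h3 : 0 < cr a b c * cr a b c := mul_self_pos.2 Q.cr_ne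
    by_contra hn
    push Not at hn
    nlinarith

/-- Moved back to old faces the weights agree, so `u` and `w` differ by a multiple of the circuit.
It is zero: the circuit is negative at both `a` and `b`, while each nonnegative weight vanishes at
one of them. -/
lemma new_weight_unique {x : Plane} {u w : Plane →₀ ℝ}
    (hu : IsWeight {a, b, c, d} x u) (hw : IsWeight {a, b, c, d} x w)
    (hu0 : u a = 0 ∨ u b = 0) (hw0 : w a = 0 ∨ w b = 0) : u = w := by
  obtain ⟨τ, -, h⟩ := Q.exchange_symm hu
  obtain ⟨σ, -, h'⟩ := Q.exchange_symm hw
  have e : u - τ • circuit a b c d α β κ δ = w - σ • circuit a b c d α β κ δ := by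
    rcases h with h | h <;> rcases h' with h' | h'
    · exact T.weight_unique hc hc h h'
    · exact T.weight_unique hc hd h h'
    · exact T.weight_unique hd hc h h'
    · exact T.weight_unique hd hd h h'
  have ea := DFunLike.congr_fun e a
  have eb := DFunLike.congr_fun e b
  simp only [Finsupp.coe_sub, Finsupp.coe_smul, Pi.sub_apply, Pi.smul_apply, smul_eq_mul,
    Q.circuit_a, Q.circuit_b] at ea eb
  have hα := Q.α_pos
  have hβ := Q.β_pos
  have h1 := hu.nonneg a
  have h2 := hu.nonneg b
  have h3 := hw.nonneg a
  have h4 := hw.nonneg b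
  have hle : σ ≤ τ := by
    by_contra hn
    push Not at hn
    rcases hu0 with h0 | h0 <;> nlinarith
  have hge : τ ≤ σ := by
    by_contra hn
    push Not at hn
    rcases hw0 with h0 | h0 <;> nlinarith
  rw [le_antisymm hle hge] at e
  exact sub_left_injective e

omit hc hd in
lemma isWeight_quad_of_new {x : Plane} {w : Plane →₀ ℝ}
    (h : IsWeight {c, d, a} x w ∨ IsWeight {c, d, b} x w) :
    IsWeight {a, b, c, d} x w ∧ (w a = 0 ∨ w b = 0) := by
  rcases h with h | h
  · refine ⟨h.mono (by intro v; simp; tauto), Or.inr (h.supp b ?_)⟩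
    have h1 := Q.a_ne_b
    have h2 := Q.b_ne_c
    have h3 := Q.swap_right.b_ne_c
    simp [h1.symm, h2, h3]
  · refine ⟨h.mono (by intro v; simp; tauto), Or.inl (h.supp a ?_)⟩
    have h1 := Q.a_ne_b
    have h2 := Q.a_ne_c
    have h3 := Q.swap_right.a_ne_c
    simp [h1, h2, h3]

omit Q in
lemma translate_mem {γ : Plane} (hγ : γ ∈ Λ) : {γ + a, γ + b, γ + c} ∈ T.triangles ∧
    {γ + a, γ + b, γ + d} ∈ T.triangles := by
  rw [← vadd_triple, ← vadd_triple]
  exact ⟨T.periodic γ hγ _ hc, T.periodic γ hγ _ hd⟩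

/-- For distinct translates, no old face of one quadrilateral is an old face of the other. So `u`
moved back to an old face equals `w`, and `w` moved back equals `u`; these are weights on faces of
`T`, hence equal. -/
lemma new_weight_unique_translates {γ γ' : Plane} (hγ : γ ∈ Λ) (hγ' : γ' ∈ Λ) {x : Plane}
    {u w : Plane →₀ ℝ}
    (hu : IsWeight {γ + c, γ + d, γ + a} x u ∨ IsWeight {γ + c, γ + d, γ + b} x u)
    (hw : IsWeight {γ' + c, γ' + d, γ' + a} x w ∨ IsWeight {γ' + c, γ' + d, γ' + b} x w) :
    u = w := by
  have Q1 := Q.translate γ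
  have Q2 := Q.translate γ'
  obtain ⟨hu, hu0⟩ := isWeight_quad_of_new Q1 hu
  obtain ⟨hw, hw0⟩ := isWeight_quad_of_new Q2 hw
  obtain ⟨hc1, hd1⟩ := T.translate_mem hc hd hγ
  obtain ⟨hc2, hd2⟩ := T.translate_mem hc hd hγ'
  by_cases hγγ : γ = γ'
  · subst hγγ
    exact T.new_weight_unique Q1 hc1 hd1 hu hw hu0 hw0
  have hneg := Q.cr_mul_neg
  have hneg' : cr a b d * cr a b c < 0 := by rwa [mul_comm]
  have same : ∀ e, ({a, b, e} : Set Plane) ∈ T.triangles → ∀ γ₁ γ₂ : Plane, γ₁ ≠ γ₂ →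
      ({γ₁ + a, γ₁ + b, γ₁ + e} : Set Plane) ≠ {γ₂ + a, γ₂ + b, γ₂ + e} := by
    intro e he γ₁ γ₂ hne h
    rw [← vadd_triple, ← vadd_triple] at h
    refine hne (sub_eq_zero.1 (eq_zero_of_vadd_eq (T.finite_corners he) (T.nonempty_corners he) ?_))
    rw [sub_eq_neg_add, ← vadd_vadd, h, neg_vadd_vadd]
  have cross : ∀ e f, cr a b e * cr a b f < 0 → ∀ γ₁ γ₂ : Plane,
      ({γ₁ + a, γ₁ + b, γ₁ + e} : Set Plane) ≠ {γ₂ + a, γ₂ + b, γ₂ + f} := by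
    intro e f hef γ₁ γ₂ h
    rw [← vadd_triple, ← vadd_triple] at h
    refine vadd_triple_ne hef (-γ₂ + γ₁) ?_
    rw [← vadd_vadd, h, neg_vadd_vadd]
  obtain ⟨τ, -, h1⟩ := Q1.exchange_symm hu
  obtain ⟨σ, -, h2⟩ := Q2.exchange_symm hw
  obtain ⟨s, hs, hsu, e1⟩ : ∃ s ∈ T.triangles,
      IsWeight s x (u - τ • circuit (γ + a) (γ + b) (γ + c) (γ + d) α β κ δ) ∧
      u - τ • circuit (γ + a) (γ + b) (γ + c) (γ + d) α β κ δ = w := by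
    rcases h1 with h1 | h1
    · exact ⟨_, hc1, h1, T.quad_weight_unique Q2 hc2 hd2 hc1 (same c hc _ _ hγγ)
        (cross c d hneg _ _) h1 hw⟩
    · exact ⟨_, hd1, h1, T.quad_weight_unique Q2 hc2 hd2 hd1 (cross d c hneg' _ _)
        (same d hd _ _ hγγ) h1 hw⟩
  obtain ⟨t, ht, htw, e2⟩ : ∃ t ∈ T.triangles,
      IsWeight t x (w - σ • circuit (γ' + a) (γ' + b) (γ' + c) (γ' + d) α β κ δ) ∧
      w - σ • circuit (γ' + a) (γ' + b) (γ' + c) (γ' + d) α β κ δ = u := by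
    rcases h2 with h2 | h2
    · exact ⟨_, hc2, h2, T.quad_weight_unique Q1 hc1 hd1 hc2 (same c hc _ _ (Ne.symm hγγ))
        (cross c d hneg _ _) h2 hu⟩
    · exact ⟨_, hd2, h2, T.quad_weight_unique Q1 hc1 hd1 hd2 (cross d c hneg' _ _)
        (same d hd _ _ (Ne.symm hγγ)) h2 hu⟩
  have e3 := T.weight_unique hs ht hsu htw
  rw [e1, e2] at e3
  exact e3.symm

omit Q hc hd in
lemma mem_orbit_triple {t : Set Plane} : t ∈ orbit Λ {a, b, c} ↔
    ∃ γ ∈ Λ, t = {γ + a, γ + b, γ + c} := by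
  simp only [orbit, Set.mem_ofPred_eq, vadd_triple]

omit Q hc hd in
lemma vadd_mem_orbit {γ : Plane} (hγ : γ ∈ Λ) {s t : Set Plane} (h : t ∈ orbit Λ s) :
    γ +ᵥ t ∈ orbit Λ s := by
  obtain ⟨η, hη, rfl⟩ := h
  exact ⟨γ + η, add_mem hγ hη, by rw [vadd_vadd]⟩

omit Q hc hd in
lemma vadd_mem_orbit_iff {γ : Plane} (hγ : γ ∈ Λ) {s t : Set Plane} :
    γ +ᵥ t ∈ orbit Λ s ↔ t ∈ orbit Λ s := by
  refine ⟨fun h => ?_, vadd_mem_orbit hγ⟩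
  have := vadd_mem_orbit (neg_mem hγ) h
  rwa [neg_vadd_vadd] at this

omit Q hc hd in
lemma self_mem_orbit (s : Set Plane) : s ∈ orbit Λ s := ⟨0, zero_mem _, by simp⟩

/-- The faces obtained from those of `T` by flipping the edge `ab` to `cd`. -/
def flipFaces (T : GeometricTriangulation Λ V) (a b c d : Plane) : Set (Set Plane) :=
  (T.triangles \ (orbit Λ {a, b, c} ∪ orbit Λ {a, b, d})) ∪
    (orbit Λ {c, d, a} ∪ orbit Λ {c, d, b})

omit Q hc hd in
lemma mem_flipFaces {t : Set Plane} : t ∈ T.flipFaces a b c d ↔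
    (t ∈ T.triangles ∧ t ∉ orbit Λ {a, b, c} ∧ t ∉ orbit Λ {a, b, d}) ∨
      ∃ γ ∈ Λ, t = {γ + c, γ + d, γ + a} ∨ t = {γ + c, γ + d, γ + b} := by
  simp only [flipFaces, Set.mem_union, Set.mem_sdiff, not_or, mem_orbit_triple, and_or_left,
    exists_or]

lemma flipFaces_weight_unique {s t : Set Plane} (hs : s ∈ T.flipFaces a b c d)
    (ht : t ∈ T.flipFaces a b c d) {x : Plane} {u w : Plane →₀ ℝ} (hu : IsWeight s x u)
    (hw : IsWeight t x w) : u = w := by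
  have mixed : ∀ s ∈ T.triangles, s ∉ orbit Λ {a, b, c} → s ∉ orbit Λ {a, b, d} →
      ∀ γ ∈ Λ, ∀ u w, IsWeight s x u →
        (IsWeight {γ + c, γ + d, γ + a} x w ∨ IsWeight {γ + c, γ + d, γ + b} x w) → u = w := by
    intro s hs hsc hsd γ hγ u w hu hw
    obtain ⟨hc1, hd1⟩ := T.translate_mem hc hd hγ
    refine T.quad_weight_unique (Q.translate γ) hc1 hd1 hs ?_ ?_ hu
      (isWeight_quad_of_new (Q.translate γ) hw).1
    · exact fun h => hsc (mem_orbit_triple.2 ⟨γ, hγ, h⟩)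
    · exact fun h => hsd (mem_orbit_triple.2 ⟨γ, hγ, h⟩)
  have new : ∀ {t : Set Plane} {γ : Plane} {w : Plane →₀ ℝ},
      t = {γ + c, γ + d, γ + a} ∨ t = {γ + c, γ + d, γ + b} → IsWeight t x w →
      IsWeight {γ + c, γ + d, γ + a} x w ∨ IsWeight {γ + c, γ + d, γ + b} x w := by
    rintro t γ w (rfl | rfl) h
    · exact Or.inl h
    · exact Or.inr h
  rcases T.mem_flipFaces.1 hs with ⟨hs, hsc, hsd⟩ | ⟨γ, hγ, hs⟩ <;>
    rcases T.mem_flipFaces.1 ht with ⟨ht, htc, htd⟩ | ⟨γ', hγ', ht⟩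
  · exact T.weight_unique hs ht hu hw
  · exact mixed s hs hsc hsd γ' hγ' u w hu (new ht hw)
  · exact (mixed t ht htc htd γ hγ w u hw (new hs hu)).symm
  · exact T.new_weight_unique_translates Q hc hd hγ hγ' (new hs hu) (new ht hw)

omit hc hd in
lemma flipFaces_nondegenerate {t : Set Plane} (ht : t ∈ T.flipFaces a b c d) :
    ∃ p q r : Plane, cr p q r ≠ 0 ∧ t = {p, q, r} := by
  rcases T.mem_flipFaces.1 ht with ⟨hs, -⟩ | ⟨γ, -, rfl | rfl⟩
  · exact T.exists_eq_triple hs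
  · exact ⟨_, _, _, (Q.translate γ).symm.cr_ne, rfl⟩
  · exact ⟨_, _, _, (Q.translate γ).cr_cdb_ne, rfl⟩

omit hc hd in
-- One reweighting serves twice: the existence of `u` shows that the new faces cover the plane, and
-- the energy formula compares the heights before and after the flip.
lemma exists_weight_flipFaces {t : Set Plane} (ht : t ∈ T.triangles) {x : Plane}
    {w : Plane →₀ ℝ} (hw : IsWeight t x w) : ∃ s ∈ T.flipFaces a b c d, ∃ u, IsWeight s x u ∧
      ∃ τ : ℝ, 0 ≤ τ ∧ energy u = energy w + τ * energy (circuit a b c d α β κ δ) := by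
  by_cases ho : t ∈ orbit Λ {a, b, c} ∨ t ∈ orbit Λ {a, b, d}
  · obtain ⟨γ, hγ, hq⟩ : ∃ γ ∈ Λ, IsWeight {γ + a, γ + b, γ + c, γ + d} x w := by
      rcases ho with ho | ho
      all_goals
        obtain ⟨γ, hγ, rfl⟩ := mem_orbit_triple.1 ho
        refine ⟨γ, hγ, hw.mono ?_⟩
        intro v
        simp
        tauto
    obtain ⟨τ, hτ, h⟩ := (Q.translate γ).exchange hq
    have hE : energy (w + τ • circuit (γ + a) (γ + b) (γ + c) (γ + d) α β κ δ) =
        energy w + τ * energy (circuit a b c d α β κ δ) := by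
      rw [map_add, map_smul, Q.energy_circuit_translate, smul_eq_mul]
    rcases h with h | h
    · exact ⟨_, T.mem_flipFaces.2 (Or.inr ⟨γ, hγ, Or.inl rfl⟩), _, h, τ, hτ, hE⟩
    · exact ⟨_, T.mem_flipFaces.2 (Or.inr ⟨γ, hγ, Or.inr rfl⟩), _, h, τ, hτ, hE⟩
  · rw [not_or] at ho
    exact ⟨t, T.mem_flipFaces.2 (Or.inl ⟨ht, ho⟩), w, hw, 0, le_rfl, by simp⟩

/-- The triangulation obtained by flipping the diagonal `ab` of a convex quadrilateral to `cd`. -/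
def flip : GeometricTriangulation Λ V where
  triangles := T.flipFaces a b c d
  nondegenerate t ht := by
    obtain ⟨p, q, r, h, rfl⟩ := T.flipFaces_nondegenerate Q ht
    exact ⟨p, q, r, (affineIndependent_iff_cr p q r).2 h, rfl⟩
  cover := by
    refine Set.eq_univ_of_forall fun x => ?_
    obtain ⟨t, ht, w, hw⟩ := T.exists_isWeight x
    obtain ⟨s, hs, u, hu, -⟩ := T.exists_weight_flipFaces Q ht hw
    exact Set.mem_biUnion hs (mem_convexHull_iff_exists_isWeight.2 ⟨u, hu⟩)
  face_to_face s hs t ht := by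
    obtain ⟨p, q, r, h, hst⟩ := T.flipFaces_nondegenerate Q hs
    obtain ⟨p', q', r', h', htt⟩ := T.flipFaces_nondegenerate Q ht
    refine (convexHull_inter_eq_iff (hst ▸ indep_of_cr_ne_zero h)
      (htt ▸ indep_of_cr_ne_zero h')).2 fun x w u hw hu => ?_
    exact T.flipFaces_weight_unique Q hc hd hs ht hw hu
  periodic γ hγ t ht := by
    simp only [flipFaces, Set.mem_union, Set.mem_sdiff, T.periodic_iff hγ,
      vadd_mem_orbit_iff hγ] at ht ⊢
    exact ht
  vertices := by
    have hmem : ∀ t ∈ T.flipFaces a b c d, t ⊆ proj Λ ⁻¹' (V : Set (FlatTorus Λ)) := by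
      intro t ht
      rcases T.mem_flipFaces.1 ht with ⟨hs, -⟩ | ⟨γ, hγ, ht⟩
      · exact T.vertices_subset hs
      · obtain ⟨hc1, hd1⟩ := T.translate_mem hc hd hγ
        have hc1 := T.vertices_subset hc1
        have hd1 := T.vertices_subset hd1
        simp only [Set.insert_subset_iff, Set.singleton_subset_iff] at hc1 hd1
        rcases ht with rfl | rfl <;> simp only [Set.insert_subset_iff, Set.singleton_subset_iff] <;>
          tauto
    refine Set.Subset.antisymm (Set.sUnion_subset hmem) ?_
    rw [← T.vertices]
    rintro v ⟨t, ht, hv⟩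
    by_cases ho : t ∈ orbit Λ {a, b, c} ∨ t ∈ orbit Λ {a, b, d}
    · obtain ⟨γ, hγ, hq⟩ : ∃ γ ∈ Λ, v ∈ ({γ + c, γ + d, γ + a} : Set Plane) ∨
          v ∈ ({γ + c, γ + d, γ + b} : Set Plane) := by
        rcases ho with ho | ho
        all_goals
          obtain ⟨γ, hγ, rfl⟩ := mem_orbit_triple.1 ho
          refine ⟨γ, hγ, ?_⟩
          simp only [Set.mem_insert_iff, Set.mem_singleton_iff] at hv ⊢
          tauto
      rcases hq with hq | hq
      · exact ⟨_, T.mem_flipFaces.2 (Or.inr ⟨γ, hγ, Or.inl rfl⟩), hq⟩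
      · exact ⟨_, T.mem_flipFaces.2 (Or.inr ⟨γ, hγ, Or.inr rfl⟩), hq⟩
    · rw [not_or] at ho
      exact ⟨t, T.mem_flipFaces.2 (Or.inl ⟨ht, ho⟩), hv⟩
  finite := by
    obtain ⟨F, hF, h⟩ := T.finite
    refine ⟨F ∪ {{c, d, a}, {c, d, b}}, hF.union (Set.toFinite _), fun t ht => ?_⟩
    rcases ht with ⟨ht, -⟩ | ht | ht
    · obtain ⟨s, hs, hts⟩ := h t ht
      exact ⟨s, Or.inl hs, hts⟩
    · exact ⟨_, Or.inr (Or.inl rfl), ht⟩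
    · exact ⟨_, Or.inr (Or.inr rfl), ht⟩

lemma isFlip_flip : T.IsFlip (T.flip Q hc hd) :=
  ⟨a, b, c, d, Q.symm.a_ne_b, hc, hd, rfl⟩

lemma height_flip_le (hE : energy (circuit a b c d α β κ δ) ≤ 0) (x : Plane) :
    (T.flip Q hc hd).height x ≤ T.height x := by
  obtain ⟨t, ht, w, hw⟩ := T.exists_isWeight x
  obtain ⟨s, hs, u, hu, τ, hτ, he⟩ := T.exists_weight_flipFaces Q ht hw
  rw [T.height_eq ht hw, (T.flip Q hc hd).height_eq hs hu, he]
  nlinarith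

lemma height_flip_crossing : (T.flip Q hc hd).height (α • a + β • b) =
    κ * ‖c‖ ^ 2 + δ * ‖d‖ ^ 2 := by
  have hw := isWeight_wt (a := c) (b := d) (c := a) Q.κ_pos.le Q.δ_pos.le le_rfl
    (by rw [Q.sum_cd, add_zero])
  rw [zero_smul, add_zero, ← Q.cross] at hw
  have hmem : ({c, d, a} : Set Plane) ∈ (T.flip Q hc hd).triangles :=
    Or.inr (Or.inl (self_mem_orbit _))
  rw [(T.flip Q hc hd).height_eq hmem hw, energy_wt]
  ring

end GeometricTriangulation

/-! ### Illegal edges and descending flips. -/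

/-- An edge that is not locally Delaunay is a diagonal of a strictly convex quadrilateral. -/
lemma exists_quad_of_illegal {a b c d p : Plane} {ρ : ℝ} (h : cr a b c * cr a b d < 0)
    (hp : OnCircle {a, b, c} p ρ) (hlt : ‖d - p‖ ^ 2 < ρ) :
    ∃ α β κ δ, Quad a b c d α β κ δ ∧ energy (circuit a b c d α β κ δ) < 0 := by
  have hc0 : cr a b c ≠ 0 := fun h0 => by simp [h0] at h
  obtain ⟨α, β, μ, hs, hd⟩ := exists_coords hc0 d
  have hcr : cr a b d = μ * cr a b c := by
    rw [hd, cr_comb hs, cr_self_outer, cr_self_right]; ring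
  have hμ : μ < 0 := by
    rw [hcr] at h
    by_contra hn
    push Not at hn
    nlinarith [mul_nonneg hn (mul_self_nonneg (cr a b c))]
  -- Otherwise `d` would lie in the cone opposite to `b`, outside the circle; `hβ` is the same at
  -- `a`.
  have hα : 0 < α := by
    by_contra hn
    push Not at hn
    have hset : ({a, c, b} : Set Plane) = {a, b, c} := by ext; simp; tauto
    have := le_of_opposite_cone (by rw [hset]; exact hp) (by linarith : α + μ + β = 1) hn hμ.le
    rw [add_right_comm, ← hd] at this
    linarith
  have hβ : 0 < β := by
    by_contra hn
    push Not at hn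
    have hset : ({b, c, a} : Set Plane) = {a, b, c} := by ext; simp; tauto
    have := le_of_opposite_cone (by rw [hset]; exact hp) (by linarith : β + μ + α = 1) hn hμ.le
    rw [add_comm (β • b + μ • c), ← add_assoc, ← hd] at this
    linarith
  have hk : 0 < 1 - μ := by linarith
  have Q : Quad a b c d (α / (1 - μ)) (β / (1 - μ)) (-μ / (1 - μ)) (1 / (1 - μ)) := by
    refine ⟨by positivity, by positivity, div_pos (by linarith) hk, by positivity, ?_, ?_, ?_, hc0⟩
    · field_simp; linarith
    · field_simp; ring
    · have e : ∀ y : Plane, ∀ r : ℝ, (r / (1 - μ)) • y = (1 - μ)⁻¹ • (r • y) := by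
        intro y r
        rw [smul_smul, div_eq_inv_mul]
      rw [e, e, e, e, ← smul_add, ← smul_add]
      congr 1
      rw [hd]
      module
  refine ⟨_, _, _, _, Q, ?_⟩
  -- The circuit annihilates affine functions, so `‖x‖ ^ 2` may be replaced by the power `‖x - p‖ ^
  -- 2 - ρ`, which vanishes at `a`, `b` and `c`.
  have key : energy (circuit a b c d (α / (1 - μ)) (β / (1 - μ)) (-μ / (1 - μ)) (1 / (1 - μ))) =
      (1 / (1 - μ)) * (‖d - p‖ ^ 2 - ρ) := by
    have h0 := Q.cross_zero
    have h1 := Q.cross_one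
    have hsa := Q.sum_ab
    have hsc := Q.sum_cd
    have ha := hp a (by simp)
    have hb := hp b (by simp)
    have hc := hp c (by simp)
    generalize α / (1 - μ) = A at *
    generalize β / (1 - μ) = B at *
    generalize -μ / (1 - μ) = K at *
    generalize 1 / (1 - μ) = D at *
    simp only [circuit, map_sub, map_add, energy_single, norm_sq_plane, PiLp.sub_apply] at *
    linear_combination K * hc - A * ha - B * hb - 2 * p 0 * h0 - 2 * p 1 * h1 +
      (ρ - p 0 ^ 2 - p 1 ^ 2) * (hsc - hsa)
  rw [key]
  have : 0 < 1 / (1 - μ) := by positivity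
  nlinarith

lemma proj_eq_iff {Λ : Submodule ℤ Plane} {x y : Plane} :
    proj Λ x = proj Λ y ↔ x - y ∈ Λ := Submodule.Quotient.eq Λ

namespace GeometricTriangulation

variable {Λ : Submodule ℤ Plane} {V : Finset (FlatTorus Λ)}

/-- `ab` is an edge of the inverse image of `T` in the plane. -/
def IsEdge (T : GeometricTriangulation Λ V) (a b : Plane) : Prop :=
  a ≠ b ∧ ∃ t ∈ T.triangles, a ∈ t ∧ b ∈ t

/-- `T'` is obtained from `T` by flipping the edge `ab`, and it has smaller height, strictly so
somewhere on that edge. -/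
structure IsDescent (T T' : GeometricTriangulation Λ V) (a b : Plane) : Prop where
  isFlip : T.IsFlip T'
  height_le : ∀ x, T'.height x ≤ T.height x
  isEdge : T.IsEdge a b
  height_lt : ∃ α β : ℝ, 0 ≤ α ∧ 0 ≤ β ∧ α + β = 1 ∧
    T'.height (α • a + β • b) < α * ‖a‖ ^ 2 + β * ‖b‖ ^ 2

lemma exists_isDescent [DiscreteTopology Λ] (T : GeometricTriangulation Λ V)
    (hT : ¬ T.IsDelaunay) : ∃ T' a b, T.IsDescent T' a b := by
  obtain ⟨a, b, c, d, p, ρ, hc, hd, hside, hp, hlt⟩ := T.exists_illegal_edge hT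
  obtain ⟨α, β, κ, δ, Q, hE⟩ := exists_quad_of_illegal hside hp hlt
  refine ⟨T.flip Q hc hd, a, b, T.isFlip_flip Q hc hd, T.height_flip_le Q hc hd hE.le,
    ⟨Q.a_ne_b, _, hc, by simp, by simp⟩, α, β, Q.α_pos.le, Q.β_pos.le, Q.sum_ab, ?_⟩
  rw [T.height_flip_crossing Q hc hd]
  simp only [circuit, map_sub, map_add, energy_single] at hE
  linarith

lemma IsEdge.height_eq {T : GeometricTriangulation Λ V} {a b : Plane} (h : T.IsEdge a b)
    {α β : ℝ} (hα : 0 ≤ α) (hβ : 0 ≤ β) (hs : α + β = 1) :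
    T.height (α • a + β • b) = α * ‖a‖ ^ 2 + β * ‖b‖ ^ 2 := by
  obtain ⟨hab, t, ht, ha, hb⟩ := h
  obtain ⟨e, rfl⟩ := T.exists_third_corner ht hab ha hb
  have hw := isWeight_wt (a := a) (b := b) (c := e) hα hβ le_rfl (by rw [hs, add_zero])
  rw [zero_smul, add_zero] at hw
  rw [T.height_eq ht hw, energy_wt]
  ring

lemma IsEdge.symm {T : GeometricTriangulation Λ V} {a b : Plane} (h : T.IsEdge a b) :
    T.IsEdge b a :=
  ⟨h.1.symm, let ⟨t, ht, ha, hb⟩ := h.2; ⟨t, ht, hb, ha⟩⟩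

lemma IsEdge.translate {T : GeometricTriangulation Λ V} {a b γ : Plane} (h : T.IsEdge a b)
    (hγ : γ ∈ Λ) : T.IsEdge (γ + a) (γ + b) := by
  obtain ⟨hab, t, ht, ha, hb⟩ := h
  exact ⟨fun e => hab (add_left_cancel e), γ +ᵥ t, T.periodic γ hγ t ht,
    Set.vadd_mem_vadd_set ha, Set.vadd_mem_vadd_set hb⟩

lemma IsEdge.mem_vertices {T : GeometricTriangulation Λ V} {a b : Plane} (h : T.IsEdge a b) :
    proj Λ a ∈ V := by
  obtain ⟨-, t, ht, ha, -⟩ := h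
  exact T.vertices_subset ht ha

/-- A flipped edge does not reappear. -/
lemma IsDescent.not_isEdge {T T' T'' : GeometricTriangulation Λ V} {a b : Plane}
    (h : T.IsDescent T' a b) (hle : ∀ x, T''.height x ≤ T'.height x) : ¬ T''.IsEdge a b := by
  intro he
  obtain ⟨α, β, hα, hβ, hs, hlt⟩ := h.height_lt
  have := he.height_eq hα hβ hs
  linarith [hle (α • a + β • b)]

/-- The edges of a triangulation below `T` are at most twice as long as the faces of `T` are
wide. -/
lemma IsEdge.norm_sub_le {T T' : GeometricTriangulation Λ V} {a b : Plane} (h : T'.IsEdge a b)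
    (hle : ∀ x, T'.height x ≤ T.height x) {D : ℝ}
    (hD : ∀ t ∈ T.triangles, ∀ x ∈ convexHull ℝ t, ∀ y ∈ convexHull ℝ t, dist x y ≤ D) :
    ‖a - b‖ ≤ 2 * D := by
  -- Compare heights above `‖m‖ ^ 2` at the midpoint `m`: for `T'` it is `‖a - b‖ ^ 2 / 4`, for `T`
  -- a weighted mean of the squared distances from `m` to the corners of a face containing it.
  have hm := h.height_eq (α := 1 / 2) (β := 1 / 2) (by norm_num) (by norm_num) (by norm_num)
  set m : Plane := (1 / 2 : ℝ) • a + (1 / 2 : ℝ) • b with hmdef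
  obtain ⟨t, ht, w, hw⟩ := T.exists_isWeight m
  have hmt := mem_convexHull_iff_exists_isWeight.2 ⟨w, hw⟩
  have h1 := hle m
  rw [hm, T.height_eq ht hw] at h1
  have hD0 : 0 ≤ D := dist_nonneg.trans (hD t ht m hmt m hmt)
  have hdist : ∀ v ∈ t, ‖v - m‖ ^ 2 ≤ D ^ 2 := by
    intro v hv
    have := hD t ht v (subset_convexHull ℝ t hv) m hmt
    rw [dist_eq_norm] at this
    gcongr
  obtain ⟨x, y, z, hxyz, rfl⟩ := T.exists_eq_triple ht
  have e := eq_wt hxyz hw.supp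
  have hmass := hw.mass_eq
  have hbary := hw.bary_eq
  have wx := hw.nonneg x
  have wy := hw.nonneg y
  have wz := hw.nonneg z
  have dx := hdist x (by simp)
  have dy := hdist y (by simp)
  have dz := hdist z (by simp)
  rw [e, mass_wt] at hmass
  rw [e, bary_wt] at hbary
  rw [e, energy_wt] at h1
  generalize w x = A at *
  generalize w y = B at *
  generalize w z = C at *
  have hb0 : A * x 0 + B * y 0 + C * z 0 = m 0 := by rw [← hbary]; simp
  have hb1 : A * x 1 + B * y 1 + C * z 1 = m 1 := by rw [← hbary]; simp
  have hsum : A * ‖x - m‖ ^ 2 + B * ‖y - m‖ ^ 2 + C * ‖z - m‖ ^ 2 =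
      A * ‖x‖ ^ 2 + B * ‖y‖ ^ 2 + C * ‖z‖ ^ 2 - ‖m‖ ^ 2 := by
    simp only [norm_sq_plane, PiLp.sub_apply]
    linear_combination -2 * m 0 * hb0 - 2 * m 1 * hb1 + (m 0 ^ 2 + m 1 ^ 2) * hmass
  have hmid : 1 / 2 * ‖a‖ ^ 2 + 1 / 2 * ‖b‖ ^ 2 - ‖m‖ ^ 2 = 1 / 4 * ‖a - b‖ ^ 2 := by
    simp only [norm_sq_plane, PiLp.sub_apply, hmdef, PiLp.add_apply, PiLp.smul_apply, smul_eq_mul]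
    ring
  have hfin : A * ‖x - m‖ ^ 2 + B * ‖y - m‖ ^ 2 + C * ‖z - m‖ ^ 2 ≤ D ^ 2 := by
    calc _ ≤ A * D ^ 2 + B * D ^ 2 + C * D ^ 2 := by gcongr
      _ = D ^ 2 := by rw [← add_mul, ← add_mul, hmass, one_mul]
  refine abs_le_of_sq_le_sq' ?_ (by positivity) |>.2
  nlinarith

end GeometricTriangulation

/-! ### Counting segments modulo the lattice. -/

/-- Linear coordinates of the plane that are integral on the lattice. -/
lemma exists_lattice_coordinates (Λ : Submodule ℤ Plane) [DiscreteTopology Λ] [IsZLattice ℝ Λ] :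
    ∃ L : Fin 2 → Plane →L[ℝ] ℝ, (∀ i, ∀ γ ∈ Λ, ∃ n : ℤ, L i γ = n) ∧
      (∀ x y, (∀ i, L i x = L i y) → x = y) ∧ ∀ i, Function.Surjective (L i) := by
  have : Module.Finite ℤ Λ := ZLattice.module_finite ℝ Λ
  have : Module.Free ℤ Λ := ZLattice.module_free ℝ Λ
  have hr : Module.finrank ℤ Λ = 2 := by rw [ZLattice.rank ℝ Λ]; simp
  let b : Module.Basis (Fin 2) ℤ Λ := Module.finBasisOfFinrankEq ℤ Λ hr
  let B := b.ofZLatticeBasis ℝ Λ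
  refine ⟨fun i => LinearMap.toContinuousLinearMap (B.coord i), ?_, ?_, ?_⟩
  · intro i γ hγ
    exact ⟨b.repr ⟨γ, hγ⟩ i, b.ofZLatticeBasis_repr_apply ℝ Λ ⟨γ, hγ⟩ i⟩
  · intro x y h
    exact B.ext_elem h
  · intro i r
    refine ⟨r • B i, ?_⟩
    simp

lemma exists_norm_bound (L : Fin 2 → Plane →L[ℝ] ℝ) :
    ∃ K : ℝ, 0 < K ∧ ∀ i x, |L i x| ≤ K * ‖x‖ := by
  refine ⟨‖L 0‖ + ‖L 1‖ + 1, by positivity, fun i x => ((L i).le_opNorm x).trans ?_⟩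
  gcongr
  fin_cases i
  · simpa using by linarith [norm_nonneg (L 1)]
  · simpa using by linarith [norm_nonneg (L 0)]

/-- The number of segments of bounded length between lifts of points of `V`, up to translation
by `Λ`. -/
lemma card_segments_le {Λ : Submodule ℤ Plane} (V : Finset (FlatTorus Λ))
    (L : Fin 2 → Plane →L[ℝ] ℝ) (hL : ∀ i, ∀ γ ∈ Λ, ∃ n : ℤ, L i γ = n)
    (hinj : ∀ x y, (∀ i, L i x = L i y) → x = y) {K : ℝ} (hK : 0 < K)
    (hLK : ∀ i x, |L i x| ≤ K * ‖x‖) {D : ℝ} (hD : 0 ≤ D) (m : ℕ) (a b : ℕ → Plane)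
    (ha : ∀ i < m, proj Λ (a i) ∈ V) (hb : ∀ i < m, proj Λ (b i) ∈ V)
    (hab : ∀ i < m, ‖a i - b i‖ ≤ 2 * D)
    (hne : ∀ j < m, ∀ i < j, ∀ γ ∈ Λ, ¬ (a j = γ + a i ∧ b j = γ + b i)) :
    (m : ℝ) ≤ (V.card : ℝ) ^ 2 * (4 * K * D + 3) ^ 2 := by
  set N : ℕ := ⌈2 * K * D⌉₊ with hN
  let I : Finset ℤ := Finset.Icc (-(N : ℤ)) N
  -- Given the endpoints on the torus, the difference vector is known up to `Λ`, that is, each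
  -- coordinate up to an integer, so the floors determine it. They lie in `[-N, N]`.
  let key : ℕ → FlatTorus Λ × FlatTorus Λ × ℤ × ℤ := fun i =>
    (proj Λ (a i), proj Λ (b i), ⌊L 0 (a i - b i)⌋, ⌊L 1 (a i - b i)⌋)
  have hfloor : ∀ k, ∀ i < m, ⌊L k (a i - b i)⌋ ∈ I := by
    intro k i hi
    have h1 := (hLK k (a i - b i)).trans (mul_le_mul_of_nonneg_left (hab i hi) hK.le)
    have h2 : K * (2 * D) ≤ N := by
      have := Nat.le_ceil (2 * K * D)
      rw [← hN] at this
      linarith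
    have h3 := abs_le.1 (h1.trans h2)
    rw [Finset.mem_Icc]
    constructor
    · refine Int.le_floor.2 ?_
      push_cast
      exact h3.1
    · have := (Int.floor_le (L k (a i - b i))).trans h3.2
      exact_mod_cast this
  have hmaps : ∀ i ∈ Finset.range m, key i ∈ V ×ˢ V ×ˢ I ×ˢ I := by
    intro i hi
    rw [Finset.mem_range] at hi
    simp only [Finset.mem_product, key]
    exact ⟨ha i hi, hb i hi, hfloor 0 i hi, hfloor 1 i hi⟩
  have hlt : ∀ j < m, ∀ i < j, key i ≠ key j := by
    intro j hj i hij h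
    simp only [key, Prod.mk.injEq] at h
    obtain ⟨h1, h2, h3, h4⟩ := h
    have h1 := proj_eq_iff.1 h1.symm
    have h2 := proj_eq_iff.1 h2.symm
    have hdiff : a j - b j = a i - b i := by
      refine hinj _ _ fun k => ?_
      obtain ⟨n, hn⟩ := hL k _ (sub_mem h1 h2)
      have e : L k (a j - b j) = L k (a i - b i) + n := by
        rw [← hn, ← map_add]
        congr 1
        abel
      have hfl : ⌊L k (a i - b i)⌋ = ⌊L k (a j - b j)⌋ := by
        fin_cases k
        · exact h3
        · exact h4
      rw [e, Int.floor_add_intCast] at hfl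
      have : n = 0 := by linarith
      rw [e, this]
      simp
    refine hne j hj i hij _ h1 ⟨by abel, ?_⟩
    have : b j = a j - (a j - b j) := by abel
    rw [this, hdiff]
    abel
  have hinjOn : Set.InjOn key (Finset.range m) := by
    intro i hi j hj h
    simp only [Finset.coe_range, Set.mem_Iio] at hi hj
    rcases lt_trichotomy i j with hij | hij | hij
    · exact absurd h (hlt j hj i hij)
    · exact hij
    · exact absurd h.symm (hlt i hi j hij)
  have hcard := Finset.card_le_card_of_injOn key hmaps hinjOn
  have hI : I.card = 2 * N + 1 := by
    simp only [I, Int.card_Icc]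
    omega
  simp only [Finset.card_range, Finset.card_product, hI] at hcard
  have hcard' : (m : ℝ) ≤ V.card * (V.card * ((2 * N + 1) * (2 * N + 1))) := by
    exact_mod_cast hcard
  have hNle : (N : ℝ) ≤ 2 * K * D + 1 := (Nat.ceil_lt_add_one (by positivity)).le
  calc (m : ℝ) ≤ (V.card : ℝ) ^ 2 * (2 * N + 1) ^ 2 := by linarith
    _ ≤ (V.card : ℝ) ^ 2 * (4 * K * D + 3) ^ 2 :=
      mul_le_mul_of_nonneg_left (pow_le_pow_left₀ (by positivity) (by linarith) 2) (by positivity)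

namespace GeometricTriangulation

variable {Λ : Submodule ℤ Plane} {V : Finset (FlatTorus Λ)} (T : GeometricTriangulation Λ V)

lemma height_antitone {S : ℕ → GeometricTriangulation Λ V} {a b : ℕ → Plane} {m : ℕ}
    (hS : ∀ i < m, (S i).IsDescent (S (i + 1)) (a i) (b i)) {i j : ℕ} (hij : i ≤ j) (hj : j ≤ m)
    (x : Plane) : (S j).height x ≤ (S i).height x := by
  induction j, hij using Nat.le_induction with
  | base => exact le_rfl
  | succ j hij ih => exact ((hS j hj).height_le x).trans (ih (Nat.le_of_succ_le hj))

/-- The number of steps of a descending sequence of flips is bounded. -/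
lemma card_descent_le (L : Fin 2 → Plane →L[ℝ] ℝ) (hL : ∀ i, ∀ γ ∈ Λ, ∃ n : ℤ, L i γ = n)
    (hinj : ∀ x y, (∀ i, L i x = L i y) → x = y) {K : ℝ} (hK : 0 < K)
    (hLK : ∀ i x, |L i x| ≤ K * ‖x‖) {D : ℝ}
    {S : ℕ → GeometricTriangulation Λ V} {a b : ℕ → Plane} {m : ℕ}
    (hD : ∀ t ∈ (S 0).triangles, ∀ x ∈ convexHull ℝ t, ∀ y ∈ convexHull ℝ t, dist x y ≤ D)
    (hS : ∀ i < m, (S i).IsDescent (S (i + 1)) (a i) (b i)) :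
    (m : ℝ) ≤ (V.card : ℝ) ^ 2 * (4 * K * D + 3) ^ 2 := by
  have hD0 : 0 ≤ D := by
    obtain ⟨t, ht⟩ := (S 0).nonempty_triangles
    obtain ⟨x, hx⟩ := (S 0).nonempty_corners ht
    have hx := subset_convexHull ℝ t hx
    exact dist_nonneg.trans (hD t ht x hx x hx)
  refine card_segments_le V L hL hinj hK hLK hD0 m a b (fun i hi => (hS i hi).isEdge.mem_vertices)
    (fun i hi => (hS i hi).isEdge.symm.mem_vertices)
    (fun i hi => (hS i hi).isEdge.norm_sub_le (height_antitone hS (Nat.zero_le i) hi.le) hD) ?_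
  rintro j hj i hij γ hγ ⟨h1, h2⟩
  refine (hS i (hij.trans hj)).not_isEdge (height_antitone hS (Nat.succ_le_of_lt hij) hj.le) ?_
  have he := (hS j hj).isEdge.translate (neg_mem hγ)
  rwa [h1, h2, neg_add_cancel_left, neg_add_cancel_left] at he

end GeometricTriangulation

/-! ### Fundamental domains and the diameter. -/

lemma mem_orbit_symm {Λ : Submodule ℤ Plane} {s t : Set Plane} (h : t ∈ orbit Λ s) :
    s ∈ orbit Λ t := by
  obtain ⟨γ, hγ, rfl⟩ := h
  exact ⟨-γ, neg_mem hγ, by rw [neg_vadd_vadd]⟩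

lemma mem_orbit_trans {Λ : Submodule ℤ Plane} {s t r : Set Plane} (h : t ∈ orbit Λ s)
    (h' : r ∈ orbit Λ t) : r ∈ orbit Λ s := by
  obtain ⟨γ, hγ, rfl⟩ := h
  obtain ⟨η, hη, rfl⟩ := h'
  exact ⟨η + γ, add_mem hη hγ, by rw [vadd_vadd]⟩

namespace GeometricTriangulation

variable {Λ : Submodule ℤ Plane} {V : Finset (FlatTorus Λ)} (T : GeometricTriangulation Λ V)

lemma isConnected_face {t : Set Plane} (ht : t ∈ T.triangles) : IsConnected (convexHull ℝ t) :=
  ⟨(T.nonempty_corners ht).mono (subset_convexHull ℝ t),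
    (convex_convexHull ℝ t).isPreconnected⟩

/-- There is a connected fundamental domain consisting of lifts of faces. -/
lemma exists_isTriangleDomain [DiscreteTopology Λ] : ∃ Ω, T.IsTriangleDomain Ω := by
  obtain ⟨F, hF, hFT⟩ := T.finite
  let P : Set (Set Plane) → Prop := fun R => R ⊆ T.triangles ∧
    (∀ s ∈ R, ∀ t ∈ R, t ∈ orbit Λ s → s = t) ∧ IsConnected (⋃ t ∈ R, convexHull ℝ t)
  -- Maximality is taken for the set of represented orbits, a subset of the finite `F`, so that a
  -- maximal element exists.
  let O : Set (Set Plane) → Set (Set Plane) := fun R => {s ∈ F | ∃ t ∈ R, t ∈ orbit Λ s}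
  have hfin : (O '' {R | P R}).Finite := by
    refine hF.finite_subsets.subset ?_
    rintro _ ⟨R, -, rfl⟩
    exact fun s hs => hs.1
  have hne : (O '' {R | P R}).Nonempty := by
    obtain ⟨t, ht⟩ := T.nonempty_triangles
    refine ⟨_, {t}, ⟨by simpa using ht, by simp, ?_⟩, rfl⟩
    simpa using T.isConnected_face ht
  obtain ⟨_, ⟨R, ⟨hRT, hRinj, hRconn⟩, rfl⟩, hmax⟩ := hfin.exists_maximal hne
  refine ⟨⋃ t ∈ R, convexHull ℝ t, hRconn, R, hRT, ?_, rfl⟩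
  suffices hall : ∀ t ∈ T.triangles, ∃ s ∈ R, s ∈ orbit Λ t by
    intro t ht
    obtain ⟨s, hs, hst⟩ := hall t ht
    refine ⟨s, ⟨hs, hst⟩, ?_⟩
    rintro s' ⟨hs', hst'⟩
    exact hRinj s' hs' s hs (mem_orbit_trans (mem_orbit_symm hst') hst)
  by_contra hcon
  push Not at hcon
  obtain ⟨t₀, ht₀, hno⟩ := hcon
  let A : Set (Set Plane) := {t ∈ T.triangles | ∃ s ∈ R, s ∈ orbit Λ t}
  let B : Set (Set Plane) := {t ∈ T.triangles | ∀ s ∈ R, s ∉ orbit Λ t}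
  have hA := T.isClosed_iUnion_faces A fun t ht => ht.1
  have hB := T.isClosed_iUnion_faces B fun t ht => ht.1
  have hcov : (Set.univ : Set Plane) ⊆ (⋃ t ∈ A, convexHull ℝ t) ∪ ⋃ t ∈ B, convexHull ℝ t := by
    rw [← T.cover]
    refine Set.iUnion₂_subset fun t ht => ?_
    by_cases h : ∃ s ∈ R, s ∈ orbit Λ t
    · exact fun x hx => Or.inl (Set.mem_biUnion (show t ∈ A from ⟨ht, h⟩) hx)
    · push Not at h
      exact fun x hx => Or.inr (Set.mem_biUnion (show t ∈ B from ⟨ht, h⟩) hx)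
  have hAne : (Set.univ ∩ ⋃ t ∈ A, convexHull ℝ t).Nonempty := by
    obtain ⟨x, hx⟩ := hRconn.nonempty
    simp only [Set.mem_iUnion] at hx
    obtain ⟨t, ht, hx⟩ := hx
    exact ⟨x, trivial, Set.mem_biUnion (show t ∈ A from ⟨hRT ht, t, ht, self_mem_orbit t⟩) hx⟩
  have hBne : (Set.univ ∩ ⋃ t ∈ B, convexHull ℝ t).Nonempty := by
    obtain ⟨x, hx⟩ := (T.isConnected_face ht₀).nonempty
    exact ⟨x, trivial, Set.mem_biUnion (show t₀ ∈ B from ⟨ht₀, hno⟩) hx⟩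
  -- As the plane is connected, a face of a represented orbit meets one of a missing orbit. After
  -- translating the first into `R`, the second can be added to `R` without losing connectedness.
  obtain ⟨x, -, hxA, hxB⟩ := isPreconnected_closed_iff.1 isPreconnected_univ _ _ hA hB hcov
    hAne hBne
  simp only [Set.mem_iUnion] at hxA hxB
  obtain ⟨s, ⟨hs, r, hr, γ, hγ, hrs⟩, hxs⟩ := hxA
  obtain ⟨t, ⟨ht, hnt⟩, hxt⟩ := hxB
  have ht' := T.periodic γ hγ t ht
  have hno' : ∀ s ∈ R, s ∉ orbit Λ (γ +ᵥ t) := fun s hs h =>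
    hnt s hs (mem_orbit_trans ⟨γ, hγ, rfl⟩ h)
  have hno'' : ∀ s ∈ R, γ +ᵥ t ∉ orbit Λ s := fun s hs h => hno' s hs (mem_orbit_symm h)
  have hP : P (insert (γ +ᵥ t) R) := by
    refine ⟨Set.insert_subset ht' hRT, ?_, ?_⟩
    · rintro p (rfl | hp) q (rfl | hq) hpq
      · rfl
      · exact absurd hpq (hno' q hq)
      · exact absurd hpq (hno'' p hp)
      · exact hRinj p hp q hq hpq
    · rw [Set.biUnion_insert]
      refine IsConnected.union ⟨γ +ᵥ x, ?_, ?_⟩ (T.isConnected_face ht') hRconn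
      · rw [convexHull_vadd_set]
        exact Set.vadd_mem_vadd_set hxt
      · refine Set.mem_biUnion hr ?_
        rw [hrs, convexHull_vadd_set]
        exact Set.vadd_mem_vadd_set hxs
  have hle : O R ≤ O (insert (γ +ᵥ t) R) := by
    rintro s ⟨hs, q, hq, h⟩
    exact ⟨hs, q, Or.inr hq, h⟩
  obtain ⟨f, hf, hft⟩ := hFT _ ht'
  obtain ⟨-, q, hq, hqf⟩ := hmax ⟨_, hP, rfl⟩ hle
    (show f ∈ O (insert (γ +ᵥ t) R) from ⟨hf, _, Or.inl rfl, hft⟩)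
  exact hno' q hq (mem_orbit_trans (mem_orbit_symm hft) hqf)

variable {T}

namespace IsTriangleDomain

variable {Ω : Set Plane} (h : T.IsTriangleDomain Ω)

include h

lemma isBounded : Bornology.IsBounded Ω := by
  obtain ⟨-, R, hRT, hR, rfl⟩ := h
  obtain ⟨F, hF, hFT⟩ := T.finite
  have hRfin : R.Finite := by
    have hsub : ∀ f ∈ F, {r ∈ R | r ∈ orbit Λ f}.Subsingleton := by
      rintro f - r ⟨hr, hrf⟩ r' ⟨hr', hrf'⟩
      refine (hR r (hRT hr)).unique ⟨hr, self_mem_orbit r⟩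
        ⟨hr', mem_orbit_trans (mem_orbit_symm hrf) hrf'⟩
    refine (hF.biUnion fun f hf => (hsub f hf).finite).subset fun r hr => ?_
    obtain ⟨f, hf, hrf⟩ := hFT r (hRT hr)
    exact Set.mem_biUnion hf ⟨hr, hrf⟩
  refine (Bornology.isBounded_biUnion hRfin).2 fun r hr => ?_
  exact ((T.finite_corners (hRT hr)).isCompact_convexHull ℝ).isBounded

lemma exists_translate {t : Set Plane} (ht : t ∈ T.triangles) :
    ∃ γ ∈ Λ, ∀ x ∈ convexHull ℝ t, γ +ᵥ x ∈ Ω := by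
  obtain ⟨-, R, hRT, hR, rfl⟩ := h
  obtain ⟨s, ⟨hs, γ, hγ, rfl⟩, -⟩ := hR t ht
  refine ⟨γ, hγ, fun x hx => Set.mem_biUnion hs ?_⟩
  rw [convexHull_vadd_set]
  exact Set.vadd_mem_vadd_set hx

lemma dist_le_diam {t : Set Plane} (ht : t ∈ T.triangles) {x y : Plane}
    (hx : x ∈ convexHull ℝ t) (hy : y ∈ convexHull ℝ t) : dist x y ≤ Metric.diam Ω := by
  obtain ⟨γ, -, hγ⟩ := h.exists_translate ht
  rw [← dist_vadd_cancel_left γ x y]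
  exact Metric.dist_le_diam_of_mem h.isBounded (hγ x hx) (hγ y hy)

/-- The diameter of a fundamental domain is bounded from below in terms of the lattice. -/
lemma half_le_mul_diam {L : Plane →L[ℝ] ℝ} (hL : ∀ γ ∈ Λ, ∃ n : ℤ, L γ = n)
    (hsurj : Function.Surjective L) {K : ℝ} (hK : 0 < K) (hLK : ∀ x, |L x| ≤ K * ‖x‖) :
    1 / 2 ≤ K * Metric.diam Ω := by
  obtain ⟨y₀, hy₀⟩ := h.1.nonempty
  -- Lattice translations change `L` by integers, so every translate of `x` differs from `y₀` by at
  -- least `1 / 2` under `L`; one of them lies in `Ω`.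
  obtain ⟨x, hx⟩ := hsurj (L y₀ + 1 / 2)
  obtain ⟨t, ht, w, hw⟩ := T.exists_isWeight x
  obtain ⟨γ, hγ, hmem⟩ := h.exists_translate ht
  have hy := hmem x (mem_convexHull_iff_exists_isWeight.2 ⟨w, hw⟩)
  obtain ⟨n, hn⟩ := hL γ hγ
  have h1 := hLK ((γ +ᵥ x) - y₀)
  have h2 := Metric.dist_le_diam_of_mem h.isBounded hy hy₀
  rw [dist_eq_norm] at h2
  have h3 : L ((γ +ᵥ x) - y₀) = n + 1 / 2 := by
    rw [vadd_eq_add, map_sub, map_add, hx, hn]; ring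
  rw [h3] at h1
  refine le_trans ?_ (h1.trans (mul_le_mul_of_nonneg_left h2 hK.le))
  rcases le_or_gt 0 n with h0 | h0
  · have : (0 : ℝ) ≤ n := by exact_mod_cast h0
    exact le_trans (by linarith) (le_abs_self _)
  · have : (n : ℝ) ≤ -1 := by exact_mod_cast Int.le_sub_one_of_lt h0
    exact le_trans (by linarith) (neg_le_abs _)

end IsTriangleDomain

end GeometricTriangulation

end FlatTorusFlips

/-! ### The flip bound. -/

theorem mainTheorem6 (Λ : Submodule ℤ FlatTorusFlips.Plane) [DiscreteTopology Λ] [IsZLattice ℝ Λ] :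
    ∃ C : ℝ, ∀ (V : Finset (FlatTorusFlips.FlatTorus Λ))
      (T : FlatTorusFlips.GeometricTriangulation Λ V),
      ∃ (m : ℕ) (S : ℕ → FlatTorusFlips.GeometricTriangulation Λ V),
        S 0 = T ∧
        (∀ i < m, (S i).IsFlip (S (i + 1))) ∧
        (S m).IsDelaunay ∧
        (m : ℝ) ≤ C * T.diam ^ 2 * (V.card : ℝ) ^ 2 := by
  open FlatTorusFlips in
  obtain ⟨L, hL, hinj, hsurj⟩ := exists_lattice_coordinates Λ
  obtain ⟨K, hK, hLK⟩ := exists_norm_bound L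
  -- From `1 / 2 ≤ K * diam` one gets `3 ≤ 6 * K * diam`, so `4 * K * diam + 3 ≤ 10 * K * diam`.
  refine ⟨(10 * K) ^ 2, fun V T => ?_⟩
  have hstep : ∀ T : GeometricTriangulation Λ V, ∃ T' a b,
      ¬ T.IsDelaunay → T.IsDescent T' a b := by
    intro T
    by_cases hT : T.IsDelaunay
    · exact ⟨T, 0, 0, fun h => absurd hT h⟩
    · obtain ⟨T', a, b, h⟩ := T.exists_isDescent hT
      exact ⟨T', a, b, fun _ => h⟩
  choose next p q hnext using hstep
  let S : ℕ → GeometricTriangulation Λ V := fun i => next^[i] T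
  have hS : ∀ i, ¬ (S i).IsDelaunay → (S i).IsDescent (S (i + 1)) (p (S i)) (q (S i)) := by
    intro i hi
    have : S (i + 1) = next (S i) := Function.iterate_succ_apply' next i T
    rw [this]
    exact hnext _ hi
  have hbound : ∀ Ω, T.IsTriangleDomain Ω → ∀ m, (∀ i < m, ¬ (S i).IsDelaunay) →
      (m : ℝ) ≤ (V.card : ℝ) ^ 2 * (4 * K * Metric.diam Ω + 3) ^ 2 := fun Ω hΩ m hm =>
    GeometricTriangulation.card_descent_le L hL hinj hK hLK (S := S)
      (fun t ht x hx y hy => hΩ.dist_le_diam ht hx hy) fun i hi => hS i (hm i hi)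
  obtain ⟨Ω₀, hΩ₀⟩ := T.exists_isTriangleDomain
  have hex : ∃ m, (S m).IsDelaunay := by
    by_contra hno
    push Not at hno
    obtain ⟨m, hm⟩ := exists_nat_gt ((V.card : ℝ) ^ 2 * (4 * K * Metric.diam Ω₀ + 3) ^ 2)
    exact absurd (hbound Ω₀ hΩ₀ m fun i _ => hno i) (not_le.2 hm)
  classical
  let m := Nat.find hex
  have hm : ∀ i < m, ¬ (S i).IsDelaunay := fun i hi => Nat.find_min hex hi
  refine ⟨m, S, rfl, fun i hi => (hS i (hm i hi)).isFlip, Nat.find_spec hex, ?_⟩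
  -- The square root makes the bound linear in the diameter of `Ω`, so that it passes to the infimum
  -- by a division.
  have hΩ : ∀ Ω, T.IsTriangleDomain Ω →
      √(m : ℝ) ≤ 10 * K * Metric.diam Ω * V.card := by
    intro Ω hΩ
    have h1 := hΩ.half_le_mul_diam (hL 0) (hsurj 0) hK (hLK 0)
    have hd : 0 ≤ Metric.diam Ω := Metric.diam_nonneg
    refine Real.sqrt_le_iff.2 ⟨by positivity, (hbound Ω hΩ m hm).trans ?_⟩
    have h2 : (4 * K * Metric.diam Ω + 3) ^ 2 ≤ (10 * K * Metric.diam Ω) ^ 2 :=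
      pow_le_pow_left₀ (by positivity) (by linarith) 2
    calc _ ≤ (V.card : ℝ) ^ 2 * (10 * K * Metric.diam Ω) ^ 2 :=
          mul_le_mul_of_nonneg_left h2 (by positivity)
      _ = _ := by ring
  have hne : (Metric.diam '' {Ω : Set Plane | T.IsTriangleDomain Ω}).Nonempty := ⟨_, Ω₀, hΩ₀, rfl⟩
  have hdiam : √(m : ℝ) ≤ 10 * K * T.diam * V.card := by
    -- The division needs `V.card > 0`; for `V.card = 0` the right side vanishes whatever the
    -- diameter.
    rcases (Nat.zero_le V.card).eq_or_lt with h0 | h0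
    · have := hΩ Ω₀ hΩ₀
      rw [← h0] at this ⊢
      simpa using this
    · have hV : (0 : ℝ) < V.card := by exact_mod_cast h0
      have hc : 0 < 10 * K * V.card := by positivity
      have : √(m : ℝ) / (10 * K * V.card) ≤ T.diam := by
        refine le_csInf hne ?_
        rintro _ ⟨Ω, hΩ', rfl⟩
        rw [div_le_iff₀ hc]
        linarith [hΩ Ω hΩ']
      rw [div_le_iff₀ hc] at this
      linarith
  calc (m : ℝ) = √(m : ℝ) ^ 2 := (Real.sq_sqrt (Nat.cast_nonneg m)).symm
    _ ≤ (10 * K * T.diam * V.card) ^ 2 := pow_le_pow_left₀ (Real.sqrt_nonneg _) hdiam 2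
    _ = (10 * K) ^ 2 * T.diam ^ 2 * (V.card : ℝ) ^ 2 := by ring
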